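/- **Model.** Fix an integer $c\ge 1$. An input network is a finite simple undirected graph (not necessarily connected) with $n$ nodes, where every node knows $n$, has a unique identifier in $\{1,\dots,n^c\}$, an input label, a numbering (by ports) of its incident half-edges, and an input label on each of these half-edges. An outcome $\mathrm O$ maps every input network to a probability distribution over output labelings. For a set $A$ of nodes, the radius-$T$ view of $A$ consists of the nodes at distance at most $T$ from $A$ with all their inputs, and of the edges between them that have an endpoint at distance less than $T$ from $A$ (with their port numbers). Given $T:\mathbb N\to\mathbb N$, $\mathrm O$ is non-signaling beyond distance $T(n)$ (has locality $T$) on a family of inputs if, for all $n$-node inputs $G,H$ of the family, all node sets $A\subseteq V(G)$, $B\subseteq V(H)$ and every $\varphi:V(G)\to V(H)$ that is an isomorphism between the radius-$0$ views and between the radius-$T(n)$ views of $A$ and $B$, the restrictions of $\mathrm O(G)$ to $A$ and of $\mathrm O(H)$ to $B$ are isomorphic under $\varphi$. $\mathrm O$ solves a problem with failure probability $p(n)$ if on every $n$-node input of the problem its output is invalid with probability at most $p(n)$. **Linearizable problems.** A linearizable problem $\Pi^{\mathsf{linearizable}}=(\Sigma,(F,L,P),B)$ consists of a finite label set $\Sigma$,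 sets $F,L\subseteq\Sigma$ and $P\subseteq\Sigma\times\Sigma$, a finite list $B$ of multisets over $\Sigma$, and a finite set $D\subset\mathbb N$ of admissible hyperedge sizes ($D=\{1,\dots,r\}$ for hypergraphs of rank at most $r$, $D=\{2\}$ for graphs). Its inputs are the bipartite incidence graphs of hypergraphs, with colors given: white nodes are the nodes and black nodes the hyperedges of the hypergraph, and black degrees lie in $D$. Every edge gets a label from $\Sigma$ (output by its white endpoint) such that, at every white node, in port order, the first label is in $F$, the last is in $L$ and all pairs of consecutive labels are in $P$ (no condition for degree $0$), and, at every black node, the multiset of labels of the incident edges is in $B$. **Gadgets.** A tree-like gadget of height $\ell\ge 1$ is the complete binary tree with levels $0,\dots,\ell-1$ in which, in addition, consecutive nodes of every level are joined by an edge. An octopus gadget consists of a tree-like gadget (the head-gadget) in which every leaf is joined to the roots of one or two further tree-like gadgets (the port-gadgets, of arbitrary heights). A proper instance is a graph made of disjoint octopus gadgets and an independent set of inter-octopus nodes, where the left-most leaf of each port-gadget is joined to exactly one inter-octopus node and there are no other edges between octopus gadgets or between them and inter-octopus nodes. Let $\mathcal G$ be the family of proper instances labeled in the intended way: every node is labeled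 as head-gadget, port-gadget or inter-octopus node, and every half-edge is labeled with its direction (left, right, parent, left child, right child, first or second port-gadget, up to the head-gadget, outward, inward). Membership in $\mathcal G$ is expressed by local constraints at all nodes. **Lifted problems.** The problem $\Pi^{\mathsf{promise}}$, on the graphs of $\mathcal G$ whose inter-octopus nodes have degrees in $D$, asks every node outside the port-gadgets to output $\bot$ and every node of a port-gadget to output a label of $\Sigma$ that is the same throughout the port-gadget, so that in every octopus gadget, with its port-gadgets in left-to-right order, the first label is in $F$, the last is in $L$ and consecutive labels are in $P$, and so that at every inter-octopus node the multiset of labels of the incident port-gadgets is in $B$. The problem $\Pi^{\mathsf{badGraph}}$, on arbitrarily labeled graphs, asks every node to be unmarked or marked. A marked node either claims an error, which is allowed only if its local constraints fail, or outputs the label of one of its half-edges, as a pointer to a marked node. The target of a pointer must claim an error, or point with the same half-edge label inside the same kind of gadget, or point in a strictly later phase, where the phases are, in order: (1) port-gadget, parent; (2) port-gadget, up; (3) head-gadget, parent; (4) head-gadget, right child; (5) head-gadget, left or right; (6) head-gadget, first or second port-gadget; (7) port-gadget, right child; (8) port-gadget, left or right; (9) port-gadget, outward; no other pointers are allowed.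 The graph induced by the unmarked nodes must satisfy the local constraints of $\mathcal G$. The problem $\Pi=\mathrm{lift}(\Pi^{\mathsf{linearizable}})$, on arbitrarily labeled graphs of maximum degree at most $\max(5,\max D)$, asks to solve $\Pi^{\mathsf{badGraph}}$ and then $\Pi^{\mathsf{promise}}$ on the graph induced by the unmarked nodes, where inter-octopus nodes whose remaining degree is not in $D$ have no constraint. **Statement.** Let $\Pi^{\mathsf{linearizable}}$ be any linearizable problem. 1. There is a constant $C>0$ such that the following holds for every non-increasing $p:\mathbb N\to\mathbb R$ bounded above by a constant $q<1$ and every $T:\mathbb N\to\mathbb N$. If some outcome that is non-signaling beyond distance $T(n)$ solves $\Pi^{\mathsf{promise}}$, or solves $\Pi$, with failure probability at most $p(n)$, then for some $T'$ there is an outcome that is non-signaling beyond distance $T'(n)$ and solves $\Pi^{\mathsf{linearizable}}$ with failure probability at most $p(n)$, where $T'(n)\le C\,T(n^3)/\log n$ for all sufficiently large $n$. 2. There is a constant $\kappa>0$ such that the following holds for every such $p$ and every $T:\mathbb N\to\mathbb R$. Suppose that $T$ is a lower bound on the locality of $\Pi^{\mathsf{linearizable}}$: every non-signaling outcome that solves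 it with failure probability at most $p(n)$ has locality at least $T(n)$ for all sufficiently large $n$. Then every non-signaling outcome that solves $\Pi^{\mathsf{promise}}$, or that solves $\Pi$, with failure probability at most $p(n)$ has locality at least $\kappa\,T(\lfloor n^{1/3}\rfloor)\log n$ for all sufficiently large $n$. -/

import Mathlib

open Filter

/-! ### Networks -/

/-- An input network `(G, x)`: a finite simple graph (not necessarily connected) whose nodes carry
a unique identifier from `{1, …, n ^ c}`, an input label from `X`, and a port numbering
`0, …, deg v - 1` of their incident half-edges, each of which carries an input label from `Y`.
`halfLabels v` lists the labels of the half-edges of `v` by port number (so its length is the degree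
of `v`), and `port v u` is the port number of the half-edge `(v, {v, u})`. -/
structure Network (c : ℕ) (X Y : Type) where
  V : Type
  [fintypeV : Fintype V]
  graph : SimpleGraph V
  ident : V → ℕ
  ident_injective : Function.Injective ident
  ident_mem : ∀ v, ident v ∈ Set.Icc 1 (Fintype.card V ^ c)
  label : V → X
  halfLabels : V → List Y
  port : V → V → ℕ
  port_bijOn : ∀ v, Set.BijOn (port v) (graph.neighborSet v) (Set.Iio (halfLabels v).length)

attribute [instance] Network.fintypeV

namespace Network

variable {c : ℕ} {X Y : Type}

/-- The number `n` of nodes. -/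
def size (N : Network c X Y) : ℕ := Fintype.card N.V

noncomputable def degree (N : Network c X Y) (v : N.V) : ℕ := (N.graph.neighborSet v).ncard

/-- The nodes at distance at most `T` from the set `A`. -/
def ball (N : Network c X Y) (A : Set N.V) (T : ℕ) : Set N.V :=
  {v | ∃ a ∈ A, N.graph.edist a v ≤ (T : ℕ∞)}

/-- The nodes at distance strictly less than `T` from the set `A`. -/
def openBall (N : Network c X Y) (A : Set N.V) (T : ℕ) : Set N.V :=
  {v | ∃ a ∈ A, N.graph.edist a v < (T : ℕ∞)}

/-- The edges of the radius-`T` view of `A`: edges between nodes at distance at most `T` from `A`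
that have an endpoint at distance less than `T` from `A`. -/
def ViewAdj (N : Network c X Y) (A : Set N.V) (T : ℕ) (u w : N.V) : Prop :=
  N.graph.Adj u w ∧ u ∈ N.ball A T ∧ w ∈ N.ball A T ∧ (u ∈ N.openBall A T ∨ w ∈ N.openBall A T)

/-- `φ` is an isomorphism from the radius-`T` view of `A` in `G` to the radius-`T` view of `B`
in `H`. It preserves the visible nodes and edges, the port numbers of the visible edges, and the
whole input of every visible node: its identifier, its label and the labels of all its
half-edges (hence its degree). -/
structure ViewIso (G H : Network c X Y) (A : Set G.V) (B : Set H.V) (T : ℕ)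
    (φ : G.V → H.V) : Prop where
  bijOn : Set.BijOn φ (G.ball A T) (H.ball B T)
  adj_iff : ∀ u ∈ G.ball A T, ∀ w ∈ G.ball A T,
    (G.ViewAdj A T u w ↔ H.ViewAdj B T (φ u) (φ w))
  port_eq : ∀ u w, G.ViewAdj A T u w → G.port u w = H.port (φ u) (φ w)
  ident_eq : ∀ u ∈ G.ball A T, G.ident u = H.ident (φ u)
  label_eq : ∀ u ∈ G.ball A T, G.label u = H.label (φ u)
  halfLabels_eq : ∀ u ∈ G.ball A T, G.halfLabels u = H.halfLabels (φ u)

end Network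

/-! ### Problems and non-signaling outcomes -/

/-- A labeling problem on networks: the family of admissible inputs, and the valid outputs on
each of them. Every node outputs an element of `Z`. -/
structure DistProblem (c : ℕ) (X Y Z : Type) where
  inputs : Set (Network c X Y)
  Solution : (N : Network c X Y) → (N.V → Z) → Prop

/-- An outcome maps every input network to a probability distribution over output labelings. -/
def Outcome (c : ℕ) (X Y Z : Type) : Type 1 := (N : Network c X Y) → PMF (N.V → Z)

namespace DistProblem

variable {c : ℕ} {X Y Z : Type}

/-- The outcome `O` solves the problem with failure probability at most `p n` on `n`-node inputs. -/
def SolvedBy (Q : DistProblem c X Y Z) (O : Outcome c X Y Z) (p : ℕ → ℝ) : Prop :=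
  ∀ N ∈ Q.inputs, (O N).toOuterMeasure {y | ¬ Q.Solution N y} ≤ ENNReal.ofReal (p N.size)

/-- On the inputs of the problem, the outcome `O` is non-signaling beyond distance `T n`, where `n`
is the number of nodes, which is part of the input of every node: whenever the radius-`T n` views
(and the radius-`0` views) of `A` and `B` are isomorphic under `φ`, the restrictions of the two
output distributions to `A` and `B` are isomorphic under `φ`. -/
def NonSignaling (Q : DistProblem c X Y Z) (O : Outcome c X Y Z) (T : ℕ → ℕ) : Prop :=
  ∀ G ∈ Q.inputs, ∀ H ∈ Q.inputs, G.size = H.size →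
    ∀ (A : Set G.V) (B : Set H.V) (φ : G.V → H.V),
      Network.ViewIso G H A B 0 φ → Network.ViewIso G H A B (T G.size) φ →
        (O G).map (fun y (a : A) => y a.1) = (O H).map (fun y (a : A) => y (φ a.1))

/-- Some outcome of locality `T` solves the problem with failure probability at most `p`. -/
def SolvableNS (Q : DistProblem c X Y Z) (p : ℕ → ℝ) (T : ℕ → ℕ) : Prop :=
  ∃ O : Outcome c X Y Z, Q.NonSignaling O T ∧ Q.SolvedBy O p

end DistProblem

/-! ### Linearizable problems -/

/-- A linearizable problem with label set `S`. The finite set `sizes` specifies which hyperedge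
sizes (degrees of black nodes) occur in the input hypergraphs, for example `{1, …, r}` for
hypergraphs of rank at most `r`, or `{2}` for graphs. -/
structure LinearizableProblem (S : Type) where
  first : Finset S
  last : Finset S
  pairs : Finset (S × S)
  black : Finset (Multiset S)
  sizes : Finset ℕ

inductive Color
  | white
  | black

namespace LinearizableProblem

variable {S : Type}

/-- The linearizable problem as a problem on bipartite incidence graphs of hypergraphs. The edges of
the graph, that is, the half-edges of the hypergraph, are labeled by their white endpoints: a white
node outputs the list of the labels of its incident edges, in the order of its port numbers. -/
def problem (P : LinearizableProblem S) (c : ℕ) : DistProblem c Color Unit (List S) where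
  inputs := {N | (∀ u w, N.graph.Adj u w → N.label u ≠ N.label w) ∧
    ∀ u, N.label u = Color.black → N.degree u ∈ P.sizes}
  Solution N y :=
    (∀ v, N.label v = Color.white →
      (y v).length = N.degree v ∧
      (∀ s ∈ (y v).head?, s ∈ P.first) ∧
      (∀ s ∈ (y v).getLast?, s ∈ P.last) ∧
      (y v).IsChain (fun s t => (s, t) ∈ P.pairs)) ∧
    (∀ u, N.label u = Color.black →
      y u = [] ∧
      ∃ m ∈ P.black, (Set.toFinite (N.graph.neighborSet u)).toFinset.val.map
        (fun v => (y v)[N.port v u]?) = m.map some)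

end LinearizableProblem

/-! ### Labeled gadget graphs -/

/-- Node labels: nodes of head-gadgets, nodes of port-gadgets, inter-octopus nodes. -/
inductive NodeKind
  | head
  | port
  | inter

/-- Half-edge labels. The first five describe the edges inside a tree-like gadget; `portA` and
`portB` lead from a leaf of a head-gadget to the roots of its first and second port-gadget, `up`
leads back; `outward` leads from the left-most leaf of a port-gadget to an inter-octopus node, and
`inward` leads back. -/
inductive HalfKind
  | left
  | right
  | parent
  | childL
  | childR
  | portA
  | portB
  | up
  | outward
  | inward

/-- A graph whose nodes and half-edges are labeled: `step a u w` says that `{u, w}` is an edge and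
that its half-edge at `u` has label `a`. -/
structure GadgetGraph (V : Type) where
  kind : V → NodeKind
  step : HalfKind → V → V → Prop

/-- The labeled graph underlying a network. -/
def Network.gadgetGraph {c : ℕ} (N : Network c NodeKind HalfKind) : GadgetGraph N.V where
  kind := N.label
  step a u w := N.graph.Adj u w ∧ (N.halfLabels u)[N.port u w]? = some a

/-- `EdgeOK k a b l`: an edge may join a node of kind `k` to a node of kind `l` with half-edge
labels `a` and `b`, respectively. -/
inductive EdgeOK : NodeKind → HalfKind → HalfKind → NodeKind → Prop
  | left_right (k) : k ≠ .inter → EdgeOK k .left .right k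
  | right_left (k) : k ≠ .inter → EdgeOK k .right .left k
  | parent_childL (k) : k ≠ .inter → EdgeOK k .parent .childL k
  | parent_childR (k) : k ≠ .inter → EdgeOK k .parent .childR k
  | childL_parent (k) : k ≠ .inter → EdgeOK k .childL .parent k
  | childR_parent (k) : k ≠ .inter → EdgeOK k .childR .parent k
  | portA_up : EdgeOK .head .portA .up .port
  | portB_up : EdgeOK .head .portB .up .port
  | up_portA : EdgeOK .port .up .portA .head
  | up_portB : EdgeOK .port .up .portB .head
  | outward_inward : EdgeOK .port .outward .inward .inter
  | inward_outward : EdgeOK .inter .inward .outward .port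

namespace GadgetGraph

variable {V : Type}

/-- The labeled subgraph induced by a set of nodes. -/
def induce (G : GadgetGraph V) (U : Set V) : GadgetGraph U where
  kind u := G.kind u.1
  step a u w := G.step a u.1 w.1

/-- The node `u` has a half-edge with label `a`. -/
def Has (G : GadgetGraph V) (a : HalfKind) (u : V) : Prop := ∃ w, G.step a u w

/-- The constraints of a tree-like gadget at the node `u`. -/
structure TreeOK (G : GadgetGraph V) (u : V) : Prop where
  unique : ∀ a w w', G.step a u w → G.step a u w' → w = w'
  child_iff : G.Has .childL u ↔ G.Has .childR u
  siblings : ∀ x y, G.step .childL u x → G.step .childR u y → G.step .right x y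
  same_depth : ∀ v, G.step .right u v → (G.Has .childL u ↔ G.Has .childL v)
  cousins : ∀ v y x, G.step .right u v → G.step .childR u y → G.step .childL v x →
    G.step .right y x
  right_border : ∀ y, ¬ G.Has .right u → G.step .childR u y → ¬ G.Has .right y
  left_border : ∀ x, ¬ G.Has .left u → G.step .childL u x → ¬ G.Has .left x
  root : ¬ G.Has .parent u → ¬ G.Has .left u ∧ ¬ G.Has .right u

/-- The local constraints at the node `u`. A finite graph satisfies them at all its nodes if and
only if it is a proper instance with the intended labels: the nodes of kind `head` and `port` form
disjoint octopus gadgets, in which every leaf of the head-gadget is joined to the roots of one or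
two port-gadgets; the inter-octopus nodes form an independent set; and the left-most leaf of every
port-gadget, and no other node of an octopus gadget, is joined to an inter-octopus node. -/
structure LocallyOK (G : GadgetGraph V) (u : V) : Prop where
  edge : ∀ a w, G.step a u w → ∃ b, G.step b w u ∧ EdgeOK (G.kind u) a b (G.kind w)
  tree : G.kind u ≠ .inter → G.TreeOK u
  head_leaf : G.kind u = .head → (G.Has .portA u ↔ ¬ G.Has .childL u)
  head_ports : G.kind u = .head → G.Has .portB u → G.Has .portA u
  port_root : G.kind u = .port → (G.Has .up u ↔ ¬ G.Has .parent u)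
  port_leaf : G.kind u = .port →
    (G.Has .outward u ↔ ¬ G.Has .childL u ∧ ¬ G.Has .left u)

/-- `r` is the root of the right-most port-gadget that hangs from the head-gadget leaf `u`. -/
def LastPort (G : GadgetGraph V) (u r : V) : Prop :=
  G.step .portB u r ∨ (G.step .portA u r ∧ ¬ G.Has .portB u)

/-- `r` and `r'` are the roots of two consecutive port-gadgets of the same octopus gadget, in the
left-to-right order. -/
def NextPort (G : GadgetGraph V) (r r' : V) : Prop :=
  ∃ u, (G.step .portA u r ∧ G.step .portB u r') ∨
    ∃ u', G.step .right u u' ∧ G.LastPort u r ∧ G.step .portA u' r'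

/-- The output labeling `y` (where `none` plays the role of `⊥`) solves the promise problem on `G`.
The black constraint is imposed on the inter-octopus nodes whose degree is an admissible
hyperedge size. Adjacent port nodes always belong to the same port-gadget. -/
structure PromiseSolution {S : Type} [Finite V] (P : LinearizableProblem S) (G : GadgetGraph V)
    (y : V → Option S) : Prop where
  bot : ∀ u, G.kind u ≠ .port → y u = none
  lab : ∀ u, G.kind u = .port → ∃ s, y u = some s
  const : ∀ a u w, G.kind u = .port → G.kind w = .port → G.step a u w → y u = y w
  first : ∀ u r, G.kind u = .head → ¬ G.Has .left u → G.step .portA u r →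
    ∃ s ∈ P.first, y r = some s
  last : ∀ u r, G.kind u = .head → ¬ G.Has .right u → G.LastPort u r →
    ∃ s ∈ P.last, y r = some s
  pairs : ∀ r r', G.NextPort r r' → ∃ s t, (s, t) ∈ P.pairs ∧ y r = some s ∧ y r' = some t
  black : ∀ b, G.kind b = .inter → {w | G.step .inward b w}.ncard ∈ P.sizes →
    ∃ m ∈ P.black, (Set.toFinite {w | G.step .inward b w}).toFinset.val.map y = m.map some

end GadgetGraph

/-! ### Proving that a graph is bad, and the lifted problem -/

/-- Outputs for the bad-graph problem: `unmarked` is `⊥`; a marked node either claims a local error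
or points along one of its half-edges towards an error. -/
inductive Mark
  | unmarked
  | error
  | pointer (a : HalfKind)

/-- The phases that a chain of error pointers goes through: to the root of a port-gadget, to the
head-gadget, to the root of the head-gadget, down, sideways, into a port-gadget, down, sideways,
out to an inter-octopus node. The value `0` stands for pointers that are not allowed. -/
def pointerPhase : NodeKind → HalfKind → ℕ
  | .port, .parent => 1
  | .port, .up => 2
  | .head, .parent => 3
  | .head, .childR => 4
  | .head, .left => 5
  | .head, .right => 5
  | .head, .portA => 6
  | .head, .portB => 6
  | .port, .childR => 7
  | .port, .left => 8
  | .port, .right => 8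
  | .port, .outward => 9
  | _, _ => 0

namespace GadgetGraph

variable {V : Type}

/-- The marking `m` solves the bad-graph problem on `G`: errors are claimed only where a local
constraint is violated, every pointer leads to an error or to a pointer that continues in the same
direction or is in a later phase, and the graph induced by the unmarked nodes satisfies the local
constraints. -/
structure BadGraphSolution (G : GadgetGraph V) (m : V → Mark) : Prop where
  error : ∀ u, m u = .error → ¬ G.LocallyOK u
  pointer : ∀ u a, m u = .pointer a → pointerPhase (G.kind u) a ≠ 0 ∧
    ∃ w, G.step a u w ∧ (m w = .error ∨ ∃ b, m w = .pointer b ∧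
      ((b = a ∧ G.kind w = G.kind u) ∨
        pointerPhase (G.kind u) a < pointerPhase (G.kind w) b))
  unmarked : ∀ u : {u // m u = .unmarked}, (G.induce {u | m u = .unmarked}).LocallyOK u

end GadgetGraph

namespace LinearizableProblem

variable {S : Type}

/-- The promise problem: its inputs are the labeled graphs that satisfy the local constraints at all
nodes, with inter-octopus nodes of admissible degrees. -/
def promise (P : LinearizableProblem S) (c : ℕ) :
    DistProblem c NodeKind HalfKind (Option S) where
  inputs := {N | (∀ u, N.gadgetGraph.LocallyOK u) ∧
    ∀ u, N.label u = .inter → N.degree u ∈ P.sizes}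
  Solution N y := N.gadgetGraph.PromiseSolution P y

/-- The lifted problem, an LCL problem on all labeled graphs of maximum degree at most
`max 5 (max P.sizes)`: solve the bad-graph problem, and then the promise problem on the graph
induced by the unmarked nodes. -/
def lift (P : LinearizableProblem S) (c : ℕ) :
    DistProblem c NodeKind HalfKind (Mark × Option S) where
  inputs := {N | ∀ u, N.degree u ≤ max 5 (P.sizes.sup id)}
  Solution N y := N.gadgetGraph.BadGraphSolution (fun u => (y u).1) ∧
    (N.gadgetGraph.induce {u | (y u).1 = .unmarked}).PromiseSolution P (fun u => (y u.1).2)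

end LinearizableProblem

/-!
Replace every node of an input network by an octopus gadget whose port-gadgets have height of order
`log n`, and let the hyperedges be inter-octopus nodes. Walking from the root of a port-gadget to
its inter-octopus node takes about `log n` steps, so the radius-`T` views of the roots at a node `v`
are determined by the view of `v` at a radius of order `T / log n`. Disjoint padding brings the
proper instance to exactly the prescribed number of nodes, of order `n ^ 3`, and the gadget of a
node draws its identifiers from a block that depends only on the identifier of the node. Hence the
labels that an outcome for the promise problem assigns to the port-gadgets form an outcome for the
linearizable problem, and its locality is smaller by a factor of order `log n`.

On a proper instance no node can be marked: local constraints hold everywhere, and following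
pointers through the phases never ends. So solutions of the lifted problem are solutions of the
promise problem there. The lower bound is the contrapositive of the reduction, with the size of the
proper instance chosen in `[m ^ 3, (m + 1) ^ 3)` so as to minimize the locality.
-/

/-! ### Proper instances and pointers -/

theorem wellFounded_swap {α : Type*} [Finite α] {r : α → α → Prop} (hr : WellFounded r) :
    WellFounded (Function.swap r) := by
  have hirr : Std.Irrefl (Function.swap (Relation.TransGen r)) :=
    ⟨fun a => hr.transGen.irrefl.irrefl a⟩
  have hsub : Subrelation (Function.swap r) (Function.swap (Relation.TransGen r)) :=
    fun h => Relation.TransGen.single (r := r) h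
  exact hsub.wf (Finite.wellFounded_of_trans_of_irrefl _)

theorem isEmpty_of_injective_sum {α : Type*} [Finite α] {f : α ⊕ α → α}
    (hf : Function.Injective f) : IsEmpty α := by
  have hcard := Nat.card_le_card_of_injective f hf
  rw [Nat.card_sum] at hcard
  exact Finite.card_eq_zero_iff.1 (by omega)

namespace GadgetGraph

variable {V : Type} {G : GadgetGraph V}

/-- A proper instance with the intended labels: the local constraints hold everywhere, and every
edge has only one label at each endpoint. -/
structure Proper (G : GadgetGraph V) : Prop where
  ok : ∀ u, G.LocallyOK u
  label_unique : ∀ a b u w, G.step a u w → G.step b u w → a = b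

/-- Two nodes are on the same level of a tree-like gadget if a path of left and right edges joins
them. -/
def SameLevel (G : GadgetGraph V) : V → V → Prop :=
  Relation.ReflTransGen fun u w => G.step .right u w ∨ G.step .right w u

theorem SameLevel.symm {u w : V} (h : G.SameLevel u w) : G.SameLevel w u :=
  have : Std.Symm fun u w => G.step .right u w ∨ G.step .right w u := ⟨fun _ _ => Or.symm⟩
  Relation.ReflTransGen.stdSymm.symm _ _ h

theorem SameLevel.of_right {u w : V} (h : G.step .right u w) : G.SameLevel u w :=
  .single (.inl h)

namespace Proper

theorem step_reverse (hG : G.Proper) {a b : HalfKind} {u w : V} (h : G.step a u w)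
    (hab : ∀ k l b', EdgeOK k a b' l → b' = b) : G.step b w u := by
  obtain ⟨b', hb', he⟩ := (hG.ok u).edge a w h
  rwa [← hab _ _ _ he]

theorem right_of_left (hG : G.Proper) {u w : V} (h : G.step .left u w) : G.step .right w u :=
  hG.step_reverse h (by rintro _ _ _ ⟨⟩; rfl)

theorem parent_of_childL (hG : G.Proper) {u w : V} (h : G.step .childL u w) :
    G.step .parent w u :=
  hG.step_reverse h (by rintro _ _ _ ⟨⟩; rfl)

theorem parent_of_childR (hG : G.Proper) {u w : V} (h : G.step .childR u w) :
    G.step .parent w u :=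
  hG.step_reverse h (by rintro _ _ _ ⟨⟩; rfl)

theorem child_of_parent (hG : G.Proper) {u w : V} (h : G.step .parent u w) :
    G.step .childL w u ∨ G.step .childR w u := by
  obtain ⟨b, hb, he⟩ := (hG.ok u).edge _ _ h
  generalize G.kind u = k at he
  generalize G.kind w = l at he
  cases he with
  | parent_childL => exact .inl hb
  | parent_childR => exact .inr hb

theorem treeOK (hG : G.Proper) {a : HalfKind} {u w : V} (h : G.step a u w) (ha : a ≠ .inward) :
    G.TreeOK u := by
  refine (hG.ok u).tree fun hk => ?_
  obtain ⟨b, -, he⟩ := (hG.ok u).edge _ _ h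
  rw [hk] at he
  generalize G.kind w = l at he
  cases he <;> contradiction

theorem step_unique (hG : G.Proper) {a : HalfKind} {u w w' : V} (h : G.step a u w)
    (h' : G.step a u w') (ha : a ≠ .inward := by nofun) : w = w' :=
  (hG.treeOK h ha).unique a w w' h h'

theorem exists_children (hG : G.Proper) {u w : V} (h : G.step .parent w u) :
    ∃ x y, G.step .childL u x ∧ G.step .childR u y ∧ (w = x ∨ w = y) := by
  rcases hG.child_of_parent h with hw | hw
  · obtain ⟨y, hy⟩ := (hG.treeOK hw (by nofun)).child_iff.1 ⟨w, hw⟩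
    exact ⟨w, y, hw, hy, .inl rfl⟩
  · obtain ⟨x, hx⟩ := (hG.treeOK hw (by nofun)).child_iff.2 ⟨w, hw⟩
    exact ⟨x, w, hx, hw, .inr rfl⟩

theorem right_of_children (hG : G.Proper) {u x y : V} (hx : G.step .childL u x)
    (hy : G.step .childR u y) : G.step .right x y :=
  (hG.treeOK hx (by nofun)).siblings x y hx hy

theorem sameLevel_of_parent_eq (hG : G.Proper) {u x y : V} (hx : G.step .parent x u)
    (hy : G.step .parent y u) : G.SameLevel x y := by
  obtain ⟨l, r, hl, hr, hxlr⟩ := hG.exists_children hx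
  have hlr : G.SameLevel l r := .of_right (hG.right_of_children hl hr)
  have hylr : y = l ∨ y = r := (hG.child_of_parent hy).imp
    (fun h => hG.step_unique h hl) (fun h => hG.step_unique h hr)
  rcases hxlr with rfl | rfl <;> rcases hylr with rfl | rfl
  exacts [.refl, hlr, hlr.symm, .refl]

theorem sameLevel_children_of_right (hG : G.Proper) {u w x y : V} (huw : G.step .right u w)
    (hx : G.step .parent x u) (hy : G.step .parent y w) : G.SameLevel x y := by
  obtain ⟨-, r, -, hr, -⟩ := hG.exists_children hx
  obtain ⟨l, -, hl, -, -⟩ := hG.exists_children hy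
  have hrl : G.step .right r l := (hG.treeOK huw (by nofun)).cousins w r l huw hr hl
  have hxr : G.SameLevel x r := hG.sameLevel_of_parent_eq hx (hG.parent_of_childR hr)
  have hly : G.SameLevel l y := hG.sameLevel_of_parent_eq (hG.parent_of_childL hl) hy
  exact (hxr.trans (SameLevel.of_right hrl)).trans hly

theorem exists_child_iff_of_right (hG : G.Proper) {u w : V} (huw : G.step .right u w) :
    (∃ x, G.step .parent x u) ↔ ∃ y, G.step .parent y w := by
  have hchild : ∀ v, (∃ x, G.step .parent x v) ↔ G.Has .childL v := fun v =>
    ⟨fun ⟨_, hx⟩ => let ⟨l, _, hl, _⟩ := hG.exists_children hx; ⟨l, hl⟩,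
      fun ⟨l, hl⟩ => ⟨l, hG.parent_of_childL hl⟩⟩
  rw [hchild, hchild]
  exact (hG.treeOK huw (by nofun)).same_depth w huw

theorem exists_child_of_sameLevel (hG : G.Proper) {u w x : V} (huw : G.SameLevel u w)
    (hx : G.step .parent x u) : ∃ y, G.step .parent y w ∧ G.SameLevel x y := by
  induction huw with
  | refl => exact ⟨x, hx, .refl⟩
  | tail _ hvw ih =>
    obtain ⟨y, hy, hxy⟩ := ih
    rcases hvw with hvw | hwv
    · obtain ⟨z, hz⟩ := (hG.exists_child_iff_of_right hvw).1 ⟨y, hy⟩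
      exact ⟨z, hz, hxy.trans (hG.sameLevel_children_of_right hvw hy hz)⟩
    · obtain ⟨z, hz⟩ := (hG.exists_child_iff_of_right hwv).2 ⟨y, hy⟩
      exact ⟨z, hz, hxy.trans (hG.sameLevel_children_of_right hwv hz hy).symm⟩

theorem acc_parent_of_sameLevel (hG : G.Proper) {u w : V} (hu : Acc (G.step .parent) u)
    (huw : G.SameLevel u w) : Acc (G.step .parent) w := by
  induction hu generalizing w with
  | intro u _ ih =>
    refine ⟨w, fun y hy => ?_⟩
    obtain ⟨x, hx, hyx⟩ := hG.exists_child_of_sameLevel huw.symm hy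
    exact ih x hx hyx.symm

/-- The nodes with infinitely long descents would form a finite set in which every node has two
children of its own, since accessibility is the same throughout a level. -/
theorem wellFounded_parent [Finite V] (hG : G.Proper) : WellFounded (G.step .parent) := by
  let U := {u | ¬ Acc (G.step .parent) u}
  have hchildren : ∀ u : U, ∃ x y : U, G.step .childL u x ∧ G.step .childR u y := by
    rintro ⟨u, hu⟩
    obtain ⟨w, hw, hwU⟩ : ∃ w, G.step .parent w u ∧ w ∈ U := by
      by_contra! h
      exact hu ⟨u, fun w hw => not_not.1 (h w hw)⟩
    obtain ⟨x, y, hx, hy, -⟩ := hG.exists_children hw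
    have hU : ∀ z, G.step .parent z u → z ∈ U := fun z hz hacc =>
      hwU (hG.acc_parent_of_sameLevel hacc (hG.sameLevel_of_parent_eq hz hw))
    exact ⟨⟨x, hU x (hG.parent_of_childL hx)⟩, ⟨y, hU y (hG.parent_of_childR hy)⟩, hx, hy⟩
  choose x y hx hy using hchildren
  have hinj : Function.Injective (Sum.elim x y) := by
    refine Function.Injective.sumElim (fun u v huv => ?_) (fun u v huv => ?_) fun u v huv => ?_
    · exact Subtype.ext (hG.step_unique (hG.parent_of_childL (hx u))
        (hG.parent_of_childL (huv ▸ hx v)))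
    · exact Subtype.ext (hG.step_unique (hG.parent_of_childR (hy u))
        (hG.parent_of_childR (huv ▸ hy v)))
    · have hyv : G.step .childR v (x u) := huv ▸ hy v
      have hparent : (u : V) = v :=
        hG.step_unique (hG.parent_of_childL (hx u)) (hG.parent_of_childR hyv)
      exact absurd (hG.label_unique _ _ _ _ (hx u) (hparent ▸ hyv)) (by nofun)
  have hU : IsEmpty U := isEmpty_of_injective_sum hinj
  exact ⟨fun u => not_not.1 fun hu => hU.elim ⟨u, hu⟩⟩

theorem acc_right_of_parent (hG : G.Proper) {u x : V}
    (hu : Acc (fun w v => G.step .right v w) u) (hx : G.step .parent x u) :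
    Acc (fun w v => G.step .right v w) x := by
  induction hu generalizing x with
  | intro u _ ih =>
    obtain ⟨l, r, hl, hr, hxlr⟩ := hG.exists_children hx
    have tu := hG.treeOK hl (by nofun)
    have hracc : Acc (fun w v => G.step .right v w) r := by
      refine ⟨r, fun z hz => ?_⟩
      obtain ⟨v, hv⟩ : G.Has .right u := by
        by_contra hright
        exact tu.right_border r hright hr ⟨z, hz⟩
      obtain ⟨l', hl'⟩ := (tu.same_depth v hv).1 ⟨l, hl⟩
      obtain rfl : z = l' := hG.step_unique hz (tu.cousins v r l' hv hr hl')
      exact ih v hv (hG.parent_of_childL hl')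
    rcases hxlr with rfl | rfl
    · refine ⟨x, fun z hz => ?_⟩
      rwa [hG.step_unique hz (hG.right_of_children hl hr)]
    · exact hracc

theorem wellFounded_right [Finite V] (hG : G.Proper) :
    WellFounded (fun w u => G.step .right u w) := by
  refine ⟨fun u => ?_⟩
  induction u using (wellFounded_swap hG.wellFounded_parent).induction with
  | _ u ih =>
    by_cases hparent : G.Has .parent u
    · obtain ⟨p, hp⟩ := hparent
      exact hG.acc_right_of_parent (ih p hp) hp
    · exact ⟨u, fun w hw => absurd ⟨w, hw⟩ ((hG.treeOK hw (by nofun)).root hparent).2⟩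

theorem wellFounded_pointer [Finite V] (hG : G.Proper) {a : HalfKind} {k : NodeKind}
    (ha : pointerPhase k a ≠ 0) :
    WellFounded (fun w u => G.step a u w ∧ G.kind u = k ∧ G.kind w = k) := by
  have hcross (hne : ∀ b, ¬ EdgeOK k a b k) :
      WellFounded (fun w u => G.step a u w ∧ G.kind u = k ∧ G.kind w = k) := by
    refine ⟨fun u => ⟨u, fun w ⟨huw, hu, hw⟩ => ?_⟩⟩
    obtain ⟨b, -, hb⟩ := (hG.ok u).edge _ _ huw
    rw [hu, hw] at hb
    exact absurd hb (hne b)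
  cases a with
  | left =>
    exact Subrelation.wf (fun h => hG.right_of_left h.1) (wellFounded_swap hG.wellFounded_right)
  | right => exact Subrelation.wf And.left hG.wellFounded_right
  | parent => exact Subrelation.wf And.left (wellFounded_swap hG.wellFounded_parent)
  | childL => cases k <;> exact absurd rfl ha
  | childR => exact Subrelation.wf (fun h => hG.parent_of_childR h.1) hG.wellFounded_parent
  | _ => exact hcross fun b hb => by cases k <;> cases hb

end Proper

theorem pointerPhase_le (k : NodeKind) (a : HalfKind) : pointerPhase k a ≤ 9 := by
  cases k <;> cases a <;> decide

namespace Proper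

variable {m : V → Mark}

theorem ne_pointer_of_later [Finite V] (hG : G.Proper) (hm : G.BadGraphSolution m) {k : NodeKind}
    {a : HalfKind} (hlater : ∀ w b, pointerPhase k a < pointerPhase (G.kind w) b →
      m w ≠ .pointer b) {u : V} (hk : G.kind u = k) : m u ≠ .pointer a := by
  intro hu
  have hwf := hG.wellFounded_pointer (hk ▸ (hm.pointer u a hu).1)
  induction u using hwf.induction with
  | _ u ih =>
    obtain ⟨-, w, hw, herror | ⟨b, hb, ⟨rfl, hkw⟩ | hlt⟩⟩ := hm.pointer u a hu
    · exact hm.error w herror (hG.ok w)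
    · exact ih w ⟨hw, hk, hkw.trans hk⟩ (hkw.trans hk) hb
    · exact hlater w b (hk ▸ hlt) hb

theorem ne_pointer [Finite V] (hG : G.Proper) (hm : G.BadGraphSolution m) (u : V) (a : HalfKind) :
    m u ≠ .pointer a := by
  induction hj : 9 - pointerPhase (G.kind u) a using Nat.strong_induction_on generalizing u a with
  | _ j ih =>
    refine hG.ne_pointer_of_later hm (fun w b hlt => ih _ ?_ w b rfl) rfl
    have := pointerPhase_le (G.kind w) b
    omega

theorem eq_unmarked [Finite V] (hG : G.Proper) (hm : G.BadGraphSolution m) (u : V) :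
    m u = .unmarked := by
  cases hu : m u with
  | unmarked => rfl
  | error => exact absurd (hG.ok u) (hm.error u hu)
  | pointer a => exact absurd hu (hG.ne_pointer hm u a)

end Proper

end GadgetGraph

/-! ### The promise problem inside the lifted problem -/

theorem toFinset_image_val_map {α β γ : Type*} [Finite α] [Finite β] {f : α → β} {s : Set α}
    {t : Set β} (hf : Set.InjOn f s) (hst : f '' s = t) (g : β → γ) :
    (Set.toFinite t).toFinset.val.map g = (Set.toFinite s).toFinset.val.map (g ∘ f) := by
  classical
  subst hst
  have himage : (Set.toFinite (f '' s)).toFinset = (Set.toFinite s).toFinset.image f := by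
    ext; simp
  rw [himage, Finset.image_val_of_injOn (by simpa using hf), Multiset.map_map]

namespace Network

variable {c : ℕ} {X Y : Type}

theorem degree_eq_length (N : Network c X Y) (v : N.V) :
    N.degree v = (N.halfLabels v).length := by
  rw [degree, ← (N.port_bijOn v).injOn.ncard_image, (N.port_bijOn v).image_eq, Set.ncard_Iio_nat]

theorem port_lt (N : Network c X Y) {u w : N.V} (h : N.graph.Adj u w) :
    N.port u w < (N.halfLabels u).length :=
  (N.port_bijOn u).mapsTo h

theorem exists_step (N : Network c NodeKind HalfKind) {u w : N.V} (h : N.graph.Adj u w) :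
    ∃ a, N.gadgetGraph.step a u w :=
  ⟨_, h, List.getElem?_eq_getElem (N.port_lt h)⟩

theorem proper_gadgetGraph (N : Network c NodeKind HalfKind)
    (h : ∀ u, N.gadgetGraph.LocallyOK u) : N.gadgetGraph.Proper where
  ok := h
  label_unique _ _ _ _ ha hb := Option.some.inj (ha.2.symm.trans hb.2)

end Network

/-- Numbering of the half-edges of a node of an octopus gadget by `0, …, 4`: labels that never
occur at the same node share a number. -/
def HalfKind.slot : HalfKind → Fin 5
  | .left => 0
  | .right => 1
  | .parent | .up => 2
  | .childL | .portA | .outward => 3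
  | .childR | .portB | .inward => 4

namespace GadgetGraph

variable {V : Type} {G : GadgetGraph V}

theorem LocallyOK.exists_edgeOK {u : V} (h : G.LocallyOK u) {a : HalfKind} (ha : G.Has a u) :
    ∃ b l, EdgeOK (G.kind u) a b l := by
  obtain ⟨w, hw⟩ := ha
  obtain ⟨b, -, hb⟩ := h.edge a w hw
  exact ⟨b, _, hb⟩

theorem LocallyOK.slot_injOn {u : V} (h : G.LocallyOK u) (hu : G.kind u ≠ .inter) :
    Set.InjOn HalfKind.slot {a | G.Has a u} := by
  intro a ha b hb hab
  obtain ⟨a', k, hak⟩ := h.exists_edgeOK ha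
  obtain ⟨b', l, hbl⟩ := h.exists_edgeOK hb
  have hchild := (h.tree hu).child_iff
  have hleaf := h.head_leaf
  have hports := h.head_ports
  have hroot := h.port_root
  have hout := h.port_leaf
  simp only [Set.mem_ofPred_eq] at ha hb
  generalize G.kind u = i at *
  cases hak <;> cases hbl <;> simp_all [HalfKind.slot]

theorem PromiseSolution.of_induce {S : Type} [Finite V] {P : LinearizableProblem S} {U : Set V}
    (hU : ∀ u, u ∈ U) {y : V → Option S}
    (h : (G.induce U).PromiseSolution P (fun u => y u.1)) : G.PromiseSolution P y where
  bot u hu := h.bot ⟨u, hU u⟩ hu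
  lab u hu := h.lab ⟨u, hU u⟩ hu
  const a u w hu hw hs := h.const a ⟨u, hU u⟩ ⟨w, hU w⟩ hu hw hs
  first u r hu hl hs := h.first ⟨u, hU u⟩ ⟨r, hU r⟩ hu (fun ⟨w, hw⟩ => hl ⟨w.1, hw⟩) hs
  last u r hu hl hs := h.last ⟨u, hU u⟩ ⟨r, hU r⟩ hu (fun ⟨w, hw⟩ => hl ⟨w.1, hw⟩)
    (hs.imp id fun hs => ⟨hs.1, fun ⟨w, hw⟩ => hs.2 ⟨w.1, hw⟩⟩)
  pairs r r' hs := by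
    refine h.pairs ⟨r, hU r⟩ ⟨r', hU r'⟩ ?_
    obtain ⟨u, hs | ⟨u', h1, h2, h3⟩⟩ := hs
    · exact ⟨⟨u, hU u⟩, .inl hs⟩
    · exact ⟨⟨u, hU u⟩, .inr ⟨⟨u', hU u'⟩, h1,
        h2.imp id fun hs => ⟨hs.1, fun ⟨w, hw⟩ => hs.2 ⟨w.1, hw⟩⟩, h3⟩⟩
  black b hb hs := by
    have himage : Subtype.val '' {w : U | (G.induce U).step .inward ⟨b, hU b⟩ w} =
        {w | G.step .inward b w} := by
      ext w
      exact ⟨fun ⟨_, hz, hzw⟩ => hzw ▸ hz, fun hw => ⟨⟨w, hU w⟩, hw, rfl⟩⟩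
    rw [← himage, Set.ncard_image_of_injective _ Subtype.val_injective] at hs
    obtain ⟨m, hm, he⟩ := h.black ⟨b, hU b⟩ hb hs
    exact ⟨m, hm, (toFinset_image_val_map Subtype.val_injective.injOn himage y).trans he⟩

end GadgetGraph

theorem Network.degree_le_five {c : ℕ} (N : Network c NodeKind HalfKind) {u : N.V}
    (h : N.gadgetGraph.LocallyOK u) (hu : N.label u ≠ .inter) : N.degree u ≤ 5 := by
  have hstep : ∀ w : N.graph.neighborSet u, ∃ a, N.gadgetGraph.step a u w :=
    fun w => N.exists_step w.2
  choose a ha using hstep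
  have hinj : Function.Injective fun w => (a w).slot := fun w w' hw =>
    have haw : a w = a w' := h.slot_injOn hu ⟨w, ha w⟩ ⟨w', ha w'⟩ hw
    Subtype.ext ((h.tree hu).unique _ _ _ (ha w) (haw ▸ ha w'))
  calc N.degree u = Nat.card (N.graph.neighborSet u) := rfl
    _ ≤ Nat.card (Fin 5) := Nat.card_le_card_of_injective _ hinj
    _ = 5 := Nat.card_fin 5

namespace LinearizableProblem

variable {S : Type} (P : LinearizableProblem S) {c : ℕ}

theorem promise_inputs_subset_lift : (P.promise c).inputs ⊆ (P.lift c).inputs := by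
  rintro N ⟨hN, hsizes⟩ u
  by_cases hu : N.label u = .inter
  · exact le_max_of_le_right (Finset.le_sup (f := id) (hsizes u hu))
  · exact le_max_of_le_left (N.degree_le_five (hN u) hu)

theorem promise_solution_of_lift {N : Network c NodeKind HalfKind} (hN : N ∈ (P.promise c).inputs)
    {y : N.V → Mark × Option S} (hy : (P.lift c).Solution N y) :
    (P.promise c).Solution N fun u => (y u).2 :=
  .of_induce (fun u => (N.proper_gadgetGraph hN.1).eq_unmarked hy.1 u) hy.2

theorem promise_solvableNS_of_lift {p : ℕ → ℝ} {T : ℕ → ℕ} (h : (P.lift c).SolvableNS p T) :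
    (P.promise c).SolvableNS p T := by
  obtain ⟨O, hO, hsol⟩ := h
  refine ⟨fun N => (O N).map fun y u => (y u).2, fun G hG H hH hGH A B φ h0 hT => ?_,
    fun N hN => ?_⟩
  · have hmap := congrArg (PMF.map fun (y : A → Mark × Option S) a => (y a).2)
      (hO G (P.promise_inputs_subset_lift hG) H (P.promise_inputs_subset_lift hH) hGH A B φ h0 hT)
    simpa only [PMF.map_comp, Function.comp_def] using hmap
  · refine le_trans ?_ (hsol N (P.promise_inputs_subset_lift hN))
    rw [PMF.toOuterMeasure_map_apply]
    exact MeasureTheory.measure_mono fun y hy hlift => hy (P.promise_solution_of_lift hN hlift)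

end LinearizableProblem

/-! ### The gadget graph of a port-numbered bipartite graph -/

theorem isPowerOfTwo_pow (e : ℕ) : (2 ^ e).isPowerOfTwo := ⟨e, rfl⟩

theorem isPowerOfTwo_two_mul_iff {k : ℕ} : (2 * k).isPowerOfTwo ↔ k.isPowerOfTwo := by
  refine ⟨fun ⟨e, he⟩ => ?_, fun hk =>
    mul_comm k 2 ▸ Nat.isPowerOfTwo_mul_two_of_isPowerOfTwo hk⟩
  cases e with
  | zero => omega
  | succ e => exact ⟨e, by rw [pow_succ] at he; omega⟩

theorem not_isPowerOfTwo_two_mul_add_one {k : ℕ} (hk : k ≠ 0) : ¬ (2 * k + 1).isPowerOfTwo := by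
  rintro ⟨_ | e, he⟩
  · rw [pow_zero] at he
    omega
  · rw [pow_succ] at he
    omega

theorem not_isPowerOfTwo_of_lt {k e : ℕ} (h1 : 2 ^ e < k) (h2 : k < 2 ^ (e + 1)) :
    ¬ k.isPowerOfTwo := by
  rintro ⟨i, rfl⟩
  rw [Nat.pow_lt_pow_iff_right (by norm_num)] at h1 h2
  omega

theorem lt_two_mul_pow_log (d : ℕ) : d < 2 * 2 ^ Nat.log 2 d := by
  have hlt := Nat.lt_pow_succ_log_self (b := 2) (by norm_num) d
  rwa [pow_succ, mul_comm] at hlt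

/-- A port-numbered bipartite graph whose nodes are coloured white and not white: the `i`-th
half-edge of `v` leads to `nbr v i`, where it is the `back v i`-th half-edge. The port-gadgets of
the white node `v` will have height `portHeight v`. -/
structure Layout (V : Type) where
  white : V → Prop
  deg : V → ℕ
  nbr : V → ℕ → V
  back : V → ℕ → ℕ
  portHeight : V → ℕ
  portHeight_pos : ∀ v, 0 < portHeight v
  white_nbr : ∀ v i, i < deg v → (white (nbr v i) ↔ ¬ white v)
  back_lt : ∀ v i, i < deg v → back v i < deg (nbr v i)
  nbr_back : ∀ v i, i < deg v → nbr (nbr v i) (back v i) = v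
  back_back : ∀ v i, i < deg v → back (nbr v i) (back v i) = i

namespace Layout

variable {V : Type} (L : Layout V)

/-- The leaf of the head-gadget from which the `i`-th of `d` port-gadgets hangs. The head-gadget has
`2 ^ Nat.log 2 d ≤ d` leaves, of which the first `d - 2 ^ Nat.log 2 d` carry two port-gadgets. -/
def leafOf (d i : ℕ) : ℕ := 2 ^ Nat.log 2 d + max (i / 2) (i - (d - 2 ^ Nat.log 2 d))

/-- The `i`-th of `d` port-gadgets is the second one of its leaf of the head-gadget. -/
def IsSecondPort (d i : ℕ) : Prop := i < 2 * (d - 2 ^ Nat.log 2 d) ∧ i % 2 = 1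

/-- The heights of the gadgets of `v`: gadget `0` is the head-gadget, gadget `i + 1` is the `i`-th
port-gadget. -/
def height (v : V) : ℕ → ℕ
  | 0 => Nat.log 2 (L.deg v) + 1
  | _ + 1 => L.portHeight v

/-- The nodes of the gadget graph: `(v, t, k)` with `k ≠ 0` is the `k`-th node, in heap order, of
gadget `t` of the white node `v`, and `(v, 0, 0)` is the inter-octopus node of the black node `v`.
A white node of degree `0` has no gadgets. -/
def Valid (x : V × ℕ × ℕ) : Prop :=
  (L.white x.1 ∧ 0 < L.deg x.1 ∧ x.2.1 ≤ L.deg x.1 ∧ x.2.2 ≠ 0 ∧ x.2.2 < 2 ^ L.height x.1 x.2.1) ∨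
    (¬ L.white x.1 ∧ x.2.1 = 0 ∧ x.2.2 = 0)

/-- The label of a node of the gadget graph. -/
def kind (x : V × ℕ × ℕ) : NodeKind :=
  if x.2.2 = 0 then .inter else if x.2.1 = 0 then .head else .port

/-- The octopus node `x` has a half-edge with label `a`. -/
def HasHalfEdge (a : HalfKind) (x : V × ℕ × ℕ) : Prop :=
  match a with
  | .left => ¬ x.2.2.isPowerOfTwo
  | .right => ¬ (x.2.2 + 1).isPowerOfTwo
  | .parent => 2 ≤ x.2.2
  | .childL => 2 * x.2.2 < 2 ^ L.height x.1 x.2.1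
  | .childR => 2 * x.2.2 < 2 ^ L.height x.1 x.2.1
  | .portA => x.2.1 = 0 ∧ 2 ^ Nat.log 2 (L.deg x.1) ≤ x.2.2
  | .portB => x.2.1 = 0 ∧ 2 ^ Nat.log 2 (L.deg x.1) ≤ x.2.2 ∧
      x.2.2 - 2 ^ Nat.log 2 (L.deg x.1) < L.deg x.1 - 2 ^ Nat.log 2 (L.deg x.1)
  | .up => x.2.1 ≠ 0 ∧ x.2.2 = 1
  | .outward => x.2.1 ≠ 0 ∧ x.2.2 = 2 ^ (L.portHeight x.1 - 1)
  | .inward => False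

/-- The other endpoint of the half-edge with label `a` of the octopus node `x`. -/
def target (a : HalfKind) (x : V × ℕ × ℕ) : V × ℕ × ℕ :=
  match a with
  | .left => (x.1, x.2.1, x.2.2 - 1)
  | .right => (x.1, x.2.1, x.2.2 + 1)
  | .parent => (x.1, x.2.1, x.2.2 / 2)
  | .childL => (x.1, x.2.1, 2 * x.2.2)
  | .childR => (x.1, x.2.1, 2 * x.2.2 + 1)
  | .portA => (x.1, x.2.2 - 2 ^ Nat.log 2 (L.deg x.1) +
      min (x.2.2 - 2 ^ Nat.log 2 (L.deg x.1)) (L.deg x.1 - 2 ^ Nat.log 2 (L.deg x.1)) + 1, 1)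
  | .portB => (x.1, 2 * (x.2.2 - 2 ^ Nat.log 2 (L.deg x.1)) + 2, 1)
  | .up => (x.1, 0, leafOf (L.deg x.1) (x.2.1 - 1))
  | .outward => (L.nbr x.1 (x.2.1 - 1), 0, 0)
  | .inward => x

/-- The left-most leaf of the port-gadget that is joined to the black node `b` at its port `j`. -/
def inwardTarget (b : V) (j : ℕ) : V × ℕ × ℕ :=
  (L.nbr b j, L.back b j + 1, 2 ^ (L.portHeight (L.nbr b j) - 1))

/-- The labeled edges of the gadget graph. -/
def step (a : HalfKind) (x y : V × ℕ × ℕ) : Prop :=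
  (x.2.2 ≠ 0 ∧ L.HasHalfEdge a x ∧ y = L.target a x) ∨
    (x.2.2 = 0 ∧ a = .inward ∧ ∃ j < L.deg x.1, y = L.inwardTarget x.1 j)

/-- The edge `x y` with label `a` at `x` leads to a node of the gadget graph and has an admissible
label at its other end. -/
def HasReverse (a : HalfKind) (x y : V × ℕ × ℕ) : Prop :=
  L.Valid y ∧ ∃ b, L.step b y x ∧ EdgeOK (kind x) a b (kind y)

variable {L}

theorem step_octopus {a : HalfKind} {x y : V × ℕ × ℕ} (hx : x.2.2 ≠ 0) :
    L.step a x y ↔ L.HasHalfEdge a x ∧ y = L.target a x := by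
  simp [step, hx]

theorem step_inter {a : HalfKind} {x y : V × ℕ × ℕ} (hx : x.2.2 = 0) :
    L.step a x y ↔ a = .inward ∧ ∃ j < L.deg x.1, y = L.inwardTarget x.1 j := by
  simp [step, hx]

theorem height_pos (v : V) (t : ℕ) : 0 < L.height v t := by
  cases t
  · exact Nat.succ_pos _
  · exact L.portHeight_pos v

theorem exists_height_eq (v : V) (t : ℕ) :
    ∃ e, L.height v t = e + 1 ∧ 2 ^ L.height v t = 2 * 2 ^ e := by
  obtain ⟨e, he⟩ := Nat.exists_eq_add_one.2 (L.height_pos v t)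
  exact ⟨e, he, by rw [he, pow_succ, mul_comm]⟩

theorem pow_log_le_leafOf (d i : ℕ) : 2 ^ Nat.log 2 d ≤ leafOf d i := Nat.le_add_right _ _

theorem leafOf_ne_zero (d i : ℕ) : leafOf d i ≠ 0 :=
  (Nat.add_pos_left (by positivity) _).ne'

theorem leafOf_lt {d i : ℕ} (hi : i < d) : leafOf d i < 2 ^ (Nat.log 2 d + 1) := by
  have hpow := Nat.pow_log_le_self 2 (Nat.ne_zero_of_lt hi)
  have hpow' := lt_two_mul_pow_log d
  rw [leafOf, pow_succ]
  omega

theorem Valid.octopus {v : V} {t k : ℕ} (h : L.Valid (v, t, k)) (hk : k ≠ 0) :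
    L.white v ∧ 0 < L.deg v ∧ t ≤ L.deg v ∧ k < 2 ^ L.height v t := by
  rcases h with ⟨hwhite, hdeg, ht, -, hlt⟩ | ⟨-, -, h⟩
  · exact ⟨hwhite, hdeg, ht, hlt⟩
  · exact absurd h hk

theorem Valid.inter {v : V} {t : ℕ} (h : L.Valid (v, t, 0)) : ¬ L.white v ∧ t = 0 := by
  rcases h with ⟨-, -, -, h, -⟩ | ⟨hblack, ht, -⟩
  · exact absurd rfl h
  · exact ⟨hblack, ht⟩

theorem valid_octopus {v : V} {t k : ℕ} (hwhite : L.white v) (hdeg : 0 < L.deg v)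
    (ht : t ≤ L.deg v) (hk : k ≠ 0) (hlt : k < 2 ^ L.height v t) : L.Valid (v, t, k) :=
  .inl ⟨hwhite, hdeg, ht, hk, hlt⟩

theorem valid_root {v : V} {t : ℕ} (hwhite : L.white v) (hdeg : 0 < L.deg v) (ht : t ≤ L.deg v) :
    L.Valid (v, t, 1) :=
  valid_octopus hwhite hdeg ht one_ne_zero (Nat.one_lt_two_pow (L.height_pos v t).ne')

theorem valid_leafOf {v : V} (hwhite : L.white v) {i : ℕ} (hi : i < L.deg v) :
    L.Valid (v, 0, leafOf (L.deg v) i) :=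
  valid_octopus hwhite (Nat.zero_lt_of_lt hi) (Nat.zero_le _) (leafOf_ne_zero _ _) (leafOf_lt hi)

theorem valid_inter {v : V} (h : ¬ L.white v) : L.Valid (v, 0, 0) := .inr ⟨h, rfl, rfl⟩

theorem valid_inwardTarget {b : V} (hb : ¬ L.white b) {j : ℕ} (hj : j < L.deg b) :
    L.Valid (L.inwardTarget b j) := by
  have hback := L.back_lt b j hj
  refine valid_octopus ((L.white_nbr b j hj).2 hb) (by omega) (by omega) (by positivity) ?_
  exact Nat.pow_lt_pow_right (by norm_num) (Nat.sub_lt (L.portHeight_pos _) one_pos)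

theorem kind_octopus {v : V} {t k : ℕ} (hk : k ≠ 0) :
    kind (v, t, k) = if t = 0 then .head else .port := by simp [kind, hk]

theorem kind_inter {v : V} {t : ℕ} : kind (v, t, 0) = .inter := by simp [kind]

theorem kind_ne_inter {v : V} {t k : ℕ} (hk : k ≠ 0) : kind (v, t, k) ≠ .inter := by
  rw [kind_octopus hk]; split <;> nofun

theorem step_portA {v : V} {i : ℕ} (hi : i < L.deg v) (hfirst : ¬ IsSecondPort (L.deg v) i) :
    L.step .portA (v, 0, leafOf (L.deg v) i) (v, i + 1, 1) := by
  have := Nat.pow_log_le_self 2 (Nat.ne_zero_of_lt hi)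
  refine (step_octopus (leafOf_ne_zero _ _)).2 ⟨⟨rfl, pow_log_le_leafOf _ _⟩, ?_⟩
  simp only [IsSecondPort] at hfirst
  simp only [target, leafOf, Prod.mk.injEq, true_and, and_true]
  omega

theorem step_portB {v : V} {i : ℕ} (hi : i < L.deg v) (hsecond : IsSecondPort (L.deg v) i) :
    L.step .portB (v, 0, leafOf (L.deg v) i) (v, i + 1, 1) := by
  have := Nat.pow_log_le_self 2 (Nat.ne_zero_of_lt hi)
  have := lt_two_mul_pow_log (L.deg v)
  simp only [IsSecondPort] at hsecond
  refine (step_octopus (leafOf_ne_zero _ _)).2 ⟨⟨rfl, pow_log_le_leafOf _ _, ?_⟩, ?_⟩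
  · simp only [leafOf]; omega
  · simp only [target, leafOf, Prod.mk.injEq, true_and, and_true]; omega

theorem hasReverse_of_same_gadget {a b : HalfKind} {v : V} {t k k' : ℕ} (hx : L.Valid (v, t, k))
    (hk : k ≠ 0) (hk' : k' ≠ 0) (hlt : k' < 2 ^ L.height v t)
    (hab : ∀ l, l ≠ .inter → EdgeOK l a b l) (hb : L.HasHalfEdge b (v, t, k'))
    (htarget : (v, t, k) = L.target b (v, t, k')) : L.HasReverse a (v, t, k) (v, t, k') := by
  obtain ⟨hwhite, hdeg, ht, -⟩ := hx.octopus hk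
  refine ⟨valid_octopus hwhite hdeg ht hk' hlt, b, (step_octopus hk').2 ⟨hb, htarget⟩, ?_⟩
  rw [kind_octopus hk', ← kind_octopus (v := v) hk]
  exact hab _ (kind_ne_inter hk)

theorem hasReverse_left {v : V} {t k : ℕ} (hx : L.Valid (v, t, k)) (hk : k ≠ 0)
    (hleft : L.HasHalfEdge .left (v, t, k)) : L.HasReverse .left (v, t, k) (v, t, k - 1) := by
  obtain ⟨-, -, -, hlt⟩ := hx.octopus hk
  have hk1 : k ≠ 1 := fun h => hleft (h ▸ Nat.isPowerOfTwo_one)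
  have hsucc : k - 1 + 1 = k := by omega
  refine hasReverse_of_same_gadget hx hk (by omega) (by omega) .left_right (b := .right) ?_ ?_
  · simpa only [HasHalfEdge, hsucc] using hleft
  · simp only [target, hsucc]

theorem hasReverse_right {v : V} {t k : ℕ} (hx : L.Valid (v, t, k)) (hk : k ≠ 0)
    (hright : L.HasHalfEdge .right (v, t, k)) : L.HasReverse .right (v, t, k) (v, t, k + 1) := by
  obtain ⟨-, -, -, hlt⟩ := hx.octopus hk
  have hne : k + 1 ≠ 2 ^ L.height v t := fun h => hright ⟨_, h⟩
  exact hasReverse_of_same_gadget hx hk (by omega) (by omega) .right_left hright rfl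

theorem hasReverse_parent {v : V} {t k : ℕ} (hx : L.Valid (v, t, k)) (hk : 2 ≤ k) :
    L.HasReverse .parent (v, t, k) (v, t, k / 2) := by
  obtain ⟨-, -, -, hlt⟩ := hx.octopus (by omega)
  obtain ⟨e, -, hpow⟩ := L.exists_height_eq v t
  rcases Nat.even_or_odd' k with ⟨s, rfl | rfl⟩
  · refine hasReverse_of_same_gadget hx (by omega) (by omega) (by omega) .parent_childL ?_ ?_
    · simp only [HasHalfEdge]; omega
    · simp only [target, Prod.mk.injEq, true_and]; omega
  · refine hasReverse_of_same_gadget hx (by omega) (by omega) (by omega) .parent_childR ?_ ?_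
    · simp only [HasHalfEdge]; omega
    · simp only [target, Prod.mk.injEq, true_and]; omega

theorem hasReverse_childL {v : V} {t k : ℕ} (hx : L.Valid (v, t, k)) (hk : k ≠ 0)
    (hlt : 2 * k < 2 ^ L.height v t) : L.HasReverse .childL (v, t, k) (v, t, 2 * k) := by
  refine hasReverse_of_same_gadget hx hk (by omega) hlt .childL_parent ?_ ?_
  · simp only [HasHalfEdge]; omega
  · simp only [target, Prod.mk.injEq, true_and]; omega

theorem hasReverse_childR {v : V} {t k : ℕ} (hx : L.Valid (v, t, k)) (hk : k ≠ 0)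
    (hlt : 2 * k < 2 ^ L.height v t) : L.HasReverse .childR (v, t, k) (v, t, 2 * k + 1) := by
  obtain ⟨e, -, hpow⟩ := L.exists_height_eq v t
  refine hasReverse_of_same_gadget hx hk (by omega) (by omega) .childR_parent ?_ ?_
  · simp only [HasHalfEdge]; omega
  · simp only [target, Prod.mk.injEq, true_and]; omega

theorem hasReverse_port {a : HalfKind} {v : V} {k i : ℕ} (hx : L.Valid (v, 0, k)) (hk : k ≠ 0)
    (hi : i < L.deg v) (hleaf : k = leafOf (L.deg v) i) (ha : EdgeOK .head a .up .port) :
    L.HasReverse a (v, 0, k) (v, i + 1, 1) := by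
  obtain ⟨hwhite, hdeg, -, -⟩ := hx.octopus hk
  refine ⟨valid_root hwhite hdeg hi, .up,
    (step_octopus one_ne_zero).2 ⟨by simp [HasHalfEdge], ?_⟩, ?_⟩
  · simp only [target, hleaf, Nat.add_sub_cancel]
  · rwa [kind_octopus hk, kind_octopus one_ne_zero]

theorem hasReverse_portA {v : V} {t k : ℕ} (hx : L.Valid (v, t, k)) (hk : k ≠ 0)
    (hport : L.HasHalfEdge .portA (v, t, k)) :
    L.HasReverse .portA (v, t, k) (L.target .portA (v, t, k)) := by
  obtain ⟨-, hdeg, -, hlt⟩ := hx.octopus hk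
  obtain ⟨ht : t = 0, hleaf : 2 ^ Nat.log 2 (L.deg v) ≤ k⟩ := hport
  subst ht
  have hpow := Nat.pow_log_le_self 2 hdeg.ne'
  simp only [height, pow_succ] at hlt
  exact hasReverse_port hx hk (by dsimp only; omega) (by simp only [leafOf]; omega) .portA_up

theorem hasReverse_portB {v : V} {t k : ℕ} (hx : L.Valid (v, t, k)) (hk : k ≠ 0)
    (hport : L.HasHalfEdge .portB (v, t, k)) :
    L.HasReverse .portB (v, t, k) (L.target .portB (v, t, k)) := by
  obtain ⟨ht : t = 0, hleaf : 2 ^ Nat.log 2 (L.deg v) ≤ k,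
    htwo : k - 2 ^ Nat.log 2 (L.deg v) < L.deg v - 2 ^ Nat.log 2 (L.deg v)⟩ := hport
  subst ht
  have hpow := lt_two_mul_pow_log (L.deg v)
  exact hasReverse_port hx hk (by dsimp only; omega) (by simp only [leafOf]; omega) .portB_up

theorem hasReverse_up {v : V} {i : ℕ} (hx : L.Valid (v, i + 1, 1)) :
    L.HasReverse .up (v, i + 1, 1) (v, 0, leafOf (L.deg v) i) := by
  obtain ⟨hwhite, -, hi, -⟩ := hx.octopus one_ne_zero
  refine ⟨valid_leafOf hwhite hi, ?_⟩
  rw [kind_octopus one_ne_zero, kind_octopus (leafOf_ne_zero _ _)]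
  by_cases hsecond : IsSecondPort (L.deg v) i
  · exact ⟨.portB, step_portB hi hsecond, .up_portB⟩
  · exact ⟨.portA, step_portA hi hsecond, .up_portA⟩

theorem hasReverse_outward {v : V} {i k : ℕ} (hx : L.Valid (v, i + 1, k))
    (hk : k = 2 ^ (L.portHeight v - 1)) :
    L.HasReverse .outward (v, i + 1, k) (L.nbr v i, 0, 0) := by
  have hk0 : k ≠ 0 := by rw [hk]; positivity
  obtain ⟨hwhite, -, hi, -⟩ := hx.octopus hk0
  refine ⟨valid_inter (by rw [L.white_nbr v i hi]; exact not_not.2 hwhite), .inward,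
    (step_inter rfl).2 ⟨rfl, L.back v i, L.back_lt v i hi, ?_⟩, ?_⟩
  · simp only [inwardTarget, L.nbr_back v i hi, L.back_back v i hi, hk]
  · rw [kind_octopus hk0, kind_inter]
    exact .outward_inward

theorem hasReverse_inward {b : V} {j : ℕ} (hb : ¬ L.white b) (hj : j < L.deg b) :
    L.HasReverse .inward (b, 0, 0) (L.inwardTarget b j) := by
  have hne : 2 ^ (L.portHeight (L.nbr b j) - 1) ≠ 0 := by positivity
  refine ⟨valid_inwardTarget hb hj, .outward, (step_octopus hne).2 ⟨?_, ?_⟩, ?_⟩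
  · simp [HasHalfEdge, inwardTarget]
  · simp [target, inwardTarget, L.nbr_back b j hj]
  · rw [inwardTarget, kind_octopus hne, kind_inter]
    exact .inward_outward

theorem hasReverse_of_step {a : HalfKind} {x y : V × ℕ × ℕ} (hx : L.Valid x)
    (h : L.step a x y) : L.HasReverse a x y := by
  obtain ⟨v, t, k⟩ := x
  rcases h with ⟨hk, ha, rfl⟩ | ⟨hk, rfl, j, hj, rfl⟩
  · cases a with
    | left => exact hasReverse_left hx hk ha
    | right => exact hasReverse_right hx hk ha
    | parent => exact hasReverse_parent hx ha
    | childL => exact hasReverse_childL hx hk ha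
    | childR => exact hasReverse_childR hx hk ha
    | portA => exact hasReverse_portA hx hk ha
    | portB => exact hasReverse_portB hx hk ha
    | up =>
      obtain ⟨ht, rfl : k = 1⟩ := ha
      obtain ⟨i, rfl⟩ := Nat.exists_eq_succ_of_ne_zero ht
      exact hasReverse_up hx
    | outward =>
      obtain ⟨ht, hk⟩ := ha
      obtain ⟨i, rfl⟩ := Nat.exists_eq_succ_of_ne_zero ht
      exact hasReverse_outward hx hk
    | inward => exact ha.elim
  · obtain rfl : k = 0 := hk
    obtain ⟨hb, rfl⟩ := hx.inter
    exact hasReverse_inward hb hj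

theorem target_injective {a b : HalfKind} {x : V × ℕ × ℕ} (hx : x.2.2 ≠ 0)
    (ha : L.HasHalfEdge a x) (hb : L.HasHalfEdge b x) (h : L.target a x = L.target b x) :
    a = b := by
  obtain ⟨v, t, k⟩ := x
  have hleft : ¬ k.isPowerOfTwo → k ≠ 1 ∧ k ≠ 2 := fun h =>
    ⟨fun h' => h (h' ▸ Nat.isPowerOfTwo_one), fun h' => h (h' ▸ isPowerOfTwo_pow 1)⟩
  have hright : ¬ (k + 1).isPowerOfTwo → k ≠ 1 := by
    rintro h rfl
    exact h (isPowerOfTwo_pow 1)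
  have hleaf := leafOf_ne_zero (L.deg v) (t - 1)
  cases a <;> cases b <;> simp only [HasHalfEdge, target, Prod.mk.injEq, true_and] at ha hb h hx <;>
    first
    | rfl
    | omega
    | have := hleft ha; omega
    | have := hleft hb; omega
    | have := hright ha; omega
    | have := hright hb; omega

theorem not_step_self {a : HalfKind} {x : V × ℕ × ℕ} : ¬ L.step a x x := by
  obtain ⟨v, t, k⟩ := x
  rintro (⟨hk, ha, h⟩ | ⟨hk, -, j, -, h⟩)
  · cases a <;> simp only [HasHalfEdge, target, Prod.mk.injEq, true_and] at ha h hk <;> omega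
  · have hpos : 2 ^ (L.portHeight (L.nbr v j) - 1) ≠ 0 := by positivity
    simp only [inwardTarget, Prod.mk.injEq] at h hk
    omega

variable (L) in
/-- The gadget graph in which every white node of positive degree is replaced by an octopus
gadget. -/
def gadgetGraph : GadgetGraph {x // L.Valid x} where
  kind x := kind x.1
  step a x y := L.step a x.1 y.1

theorem has_iff {a : HalfKind} {x : {x // L.Valid x}} (hx : x.1.2.2 ≠ 0) :
    L.gadgetGraph.Has a x ↔ L.HasHalfEdge a x.1 := by
  refine ⟨fun ⟨y, hy⟩ => ((step_octopus hx).1 hy).1, fun ha => ?_⟩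
  have hstep : L.step a x.1 (L.target a x.1) := (step_octopus hx).2 ⟨ha, rfl⟩
  exact ⟨⟨_, (hasReverse_of_step x.2 hstep).1⟩, hstep⟩

theorem step_right_siblings (v : V) (t : ℕ) {k : ℕ} (hk : k ≠ 0) :
    L.step .right (v, t, 2 * k) (v, t, 2 * k + 1) :=
  (step_octopus (mul_ne_zero two_ne_zero hk)).2 ⟨not_isPowerOfTwo_two_mul_add_one hk, rfl⟩

theorem step_right_cousins (v : V) (t : ℕ) {k : ℕ} (hk : ¬ (k + 1).isPowerOfTwo) :
    L.step .right (v, t, 2 * k + 1) (v, t, 2 * (k + 1)) :=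
  (step_octopus (Nat.succ_ne_zero _)).2 ⟨fun h => hk (isPowerOfTwo_two_mul_iff.1 h), rfl⟩

theorem hasHalfEdge_childL_right_iff {v : V} {t k : ℕ} (hk : ¬ (k + 1).isPowerOfTwo) :
    L.HasHalfEdge .childL (v, t, k) ↔ L.HasHalfEdge .childL (v, t, k + 1) := by
  obtain ⟨e, -, hpow⟩ := L.exists_height_eq v t
  have hne : k + 1 ≠ 2 ^ e := fun h => hk ⟨e, h⟩
  simp only [HasHalfEdge]
  omega

theorem hasHalfEdge_and_eq_target {a : HalfKind} {x y : {x // L.Valid x}} (hx : x.1.2.2 ≠ 0)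
    (h : L.gadgetGraph.step a x y) : L.HasHalfEdge a x.1 ∧ y.1 = L.target a x.1 :=
  (step_octopus hx).1 h

theorem not_has_left_and_not_has_right_root {v : V} {t : ℕ} (hv : L.Valid (v, t, 1)) :
    ¬ L.gadgetGraph.Has .left ⟨_, hv⟩ ∧ ¬ L.gadgetGraph.Has .right ⟨_, hv⟩ := by
  rw [has_iff one_ne_zero, has_iff one_ne_zero]
  exact ⟨not_not.2 Nat.isPowerOfTwo_one, not_not.2 (isPowerOfTwo_pow 1)⟩

theorem treeOK {x : {x // L.Valid x}} (hx : x.1.2.2 ≠ 0) : L.gadgetGraph.TreeOK x := by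
  obtain ⟨⟨v, t, k⟩, hv⟩ := x
  have hk : k ≠ 0 := hx
  constructor
  case unique =>
    exact fun a w w' h h' => Subtype.ext <|
      (hasHalfEdge_and_eq_target hx h).2.trans (hasHalfEdge_and_eq_target hx h').2.symm
  case child_iff => rw [has_iff hx, has_iff hx]; rfl
  case siblings =>
    rintro ⟨x, hxv⟩ ⟨y, hyv⟩ h h'
    obtain ⟨-, rfl⟩ := hasHalfEdge_and_eq_target hx h
    obtain ⟨-, rfl⟩ := hasHalfEdge_and_eq_target hx h'
    exact step_right_siblings v t hk
  case same_depth =>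
    rintro ⟨w, hwv⟩ h
    obtain ⟨hright, rfl⟩ := hasHalfEdge_and_eq_target hx h
    rw [has_iff hx, has_iff (Nat.succ_ne_zero k)]
    exact hasHalfEdge_childL_right_iff hright
  case cousins =>
    rintro ⟨w, hwv⟩ ⟨y, hyv⟩ ⟨z, hzv⟩ h h' h''
    obtain ⟨hright, rfl⟩ := hasHalfEdge_and_eq_target hx h
    obtain ⟨-, rfl⟩ := hasHalfEdge_and_eq_target hx h'
    obtain ⟨-, rfl⟩ := hasHalfEdge_and_eq_target (Nat.succ_ne_zero k) h''
    exact step_right_cousins v t hright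
  case right_border =>
    rintro ⟨y, hyv⟩ h h'
    obtain ⟨-, rfl⟩ := hasHalfEdge_and_eq_target hx h'
    rw [has_iff hx] at h
    rw [has_iff (Nat.succ_ne_zero (2 * k))]
    exact not_not.2 (isPowerOfTwo_two_mul_iff.2 (not_not.1 h))
  case left_border =>
    rintro ⟨y, hyv⟩ h h'
    obtain ⟨-, rfl⟩ := hasHalfEdge_and_eq_target hx h'
    rw [has_iff hx] at h
    rw [has_iff (mul_ne_zero two_ne_zero hk)]
    exact not_not.2 (isPowerOfTwo_two_mul_iff.2 (not_not.1 h))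
  case root =>
    intro h
    rw [has_iff hx] at h
    simp only [HasHalfEdge] at h
    obtain rfl : k = 1 := by omega
    exact not_has_left_and_not_has_right_root hv

theorem hasHalfEdge_outward_iff {v : V} {i k : ℕ} (hk : k ≠ 0) (hx : L.Valid (v, i + 1, k)) :
    L.HasHalfEdge .outward (v, i + 1, k) ↔
      ¬ L.HasHalfEdge .childL (v, i + 1, k) ∧ ¬ L.HasHalfEdge .left (v, i + 1, k) := by
  obtain ⟨-, -, -, hlt⟩ := hx.octopus hk
  obtain ⟨e, he, hpow⟩ := L.exists_height_eq v (i + 1)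
  simp only [HasHalfEdge, not_not, not_lt, hpow]
  simp only [height] at he
  rw [hpow] at hlt
  rw [he, Nat.add_sub_cancel]
  constructor
  · rintro ⟨-, rfl⟩
    exact ⟨le_rfl, isPowerOfTwo_pow e⟩
  · rintro ⟨hleaf, hpower⟩
    refine ⟨Nat.succ_ne_zero i, ?_⟩
    by_contra hne
    exact not_isPowerOfTwo_of_lt (e := e) (by omega) (by rw [pow_succ]; omega) hpower

theorem locallyOK (x : {x // L.Valid x}) : L.gadgetGraph.LocallyOK x := by
  obtain ⟨⟨v, t, k⟩, hv⟩ := x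
  by_cases hk : k = 0
  · subst hk
    have hkind : L.gadgetGraph.kind ⟨(v, t, 0), hv⟩ = .inter :=
      kind_inter (v := v) (t := t)
    constructor
    case edge => exact fun a w h => (hasReverse_of_step hv h).2
    all_goals exact fun h => by simp [hkind] at h
  have hkind : L.gadgetGraph.kind ⟨(v, t, k), hv⟩ = if t = 0 then .head else .port :=
    kind_octopus hk
  have ht0 (h : L.gadgetGraph.kind ⟨(v, t, k), hv⟩ = .head) : t = 0 := by
    by_contra ht; simp [hkind, ht] at h
  have ht1 (h : L.gadgetGraph.kind ⟨(v, t, k), hv⟩ = .port) : t ≠ 0 := by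
    rintro rfl; simp [hkind] at h
  constructor
  case edge => exact fun a w h => (hasReverse_of_step hv h).2
  case tree => exact fun _ => treeOK hk
  all_goals
    intro h
    simp only [has_iff (x := ⟨(v, t, k), hv⟩) hk]
  case head_leaf =>
    obtain rfl := ht0 h
    simp only [HasHalfEdge, height, pow_succ, true_and]
    omega
  case head_ports => exact fun hB => ⟨hB.1, hB.2.1⟩
  case port_root =>
    have := ht1 h
    simp only [HasHalfEdge]
    omega
  case port_leaf =>
    obtain ⟨i, rfl⟩ := Nat.exists_eq_succ_of_ne_zero (ht1 h)
    exact hasHalfEdge_outward_iff hk hv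

end Layout

/-! ### Gadget graphs as networks -/

namespace Layout

variable {V : Type} (L : Layout V)

open Classical in
/-- The labels of the half-edges of `x`, in the order of the port numbers. -/
noncomputable def labels (x : V × ℕ × ℕ) : List HalfKind :=
  if x.2.2 = 0 then List.replicate (L.deg x.1) .inward else
    [.left, .right, .parent, .childL, .childR, .portA, .portB, .up, .outward, .inward].filter
      fun a => L.HasHalfEdge a x

open Classical in
/-- The port number at `x` of the edge to `y`. -/
noncomputable def portNum (x y : V × ℕ × ℕ) : ℕ :=
  if x.2.2 = 0 then L.back y.1 (y.2.1 - 1) else (L.labels x).findIdx fun a => L.step a x y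

variable {L}

theorem mem_labels {x : V × ℕ × ℕ} (hx : x.2.2 ≠ 0) {a : HalfKind} :
    a ∈ L.labels x ↔ L.HasHalfEdge a x := by
  rw [labels, if_neg hx, List.mem_filter]
  cases a <;> simp

theorem nodup_labels {x : V × ℕ × ℕ} (hx : x.2.2 ≠ 0) : (L.labels x).Nodup := by
  rw [labels, if_neg hx]
  exact List.Nodup.filter _ (by simp)

theorem step_label_unique {a b : HalfKind} {x y : V × ℕ × ℕ} (ha : L.step a x y)
    (hb : L.step b x y) : a = b := by
  by_cases hx : x.2.2 = 0
  · rw [step_inter hx] at ha hb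
    rw [ha.1, hb.1]
  · rw [step_octopus hx] at ha hb
    exact target_injective hx ha.1 hb.1 (ha.2.symm.trans hb.2)

theorem portNum_inwardTarget {b : V} {t j : ℕ} (hj : j < L.deg b) :
    L.portNum (b, t, 0) (L.inwardTarget b j) = j := by
  rw [portNum, if_pos rfl]
  exact L.back_back b j hj

theorem labels_portNum {a : HalfKind} {x y : V × ℕ × ℕ} (h : L.step a x y) :
    (L.labels x)[L.portNum x y]? = some a := by
  classical
  by_cases hx : x.2.2 = 0
  · obtain ⟨rfl, j, hj, rfl⟩ := (step_inter hx).1 h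
    obtain ⟨v, t, k⟩ := x
    obtain rfl : k = 0 := hx
    dsimp only at hj ⊢
    rw [portNum_inwardTarget hj, labels, if_pos rfl, List.getElem?_replicate, if_pos hj]
  · have hmem : a ∈ L.labels x := (mem_labels hx).2 ((step_octopus hx).1 h).1
    have hlt : (L.labels x).findIdx (fun a => L.step a x y) < (L.labels x).length :=
      List.findIdx_lt_length_of_exists ⟨a, hmem, by simpa using h⟩
    have hstep := List.findIdx_getElem (w := hlt)
    rw [portNum, if_neg hx, List.getElem?_eq_getElem hlt]
    exact congrArg some (step_label_unique (by simpa using hstep) h)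

theorem portNum_lt {a : HalfKind} {x y : V × ℕ × ℕ} (h : L.step a x y) :
    L.portNum x y < (L.labels x).length :=
  (List.getElem?_eq_some_iff.1 (labels_portNum h)).1

theorem portNum_injective {a b : HalfKind} {x y z : V × ℕ × ℕ} (hy : L.step a x y)
    (hz : L.step b x z) (h : L.portNum x y = L.portNum x z) : y = z := by
  by_cases hx : x.2.2 = 0
  · obtain ⟨v, t, k⟩ := x
    obtain rfl : k = 0 := hx
    obtain ⟨-, j, hj, rfl⟩ := (step_inter rfl).1 hy
    obtain ⟨-, j', hj', rfl⟩ := (step_inter rfl).1 hz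
    dsimp only at hj hj' h ⊢
    rw [portNum_inwardTarget hj, portNum_inwardTarget hj'] at h
    rw [h]
  · have hab := labels_portNum hy
    rw [h, labels_portNum hz] at hab
    obtain rfl := Option.some.inj hab
    rw [step_octopus hx] at hy hz
    exact hy.2.trans hz.2.symm

theorem exists_portNum_eq {x : V × ℕ × ℕ} {i : ℕ} (hi : i < (L.labels x).length) :
    ∃ a y, L.step a x y ∧ L.portNum x y = i := by
  by_cases hx : x.2.2 = 0
  · obtain ⟨v, t, k⟩ := x
    obtain rfl : k = 0 := hx
    have hi : i < L.deg v := by simpa [labels] using hi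
    exact ⟨_, _, (step_inter rfl).2 ⟨rfl, i, hi, rfl⟩, portNum_inwardTarget hi⟩
  · have hstep : L.step (L.labels x)[i] x (L.target (L.labels x)[i] x) :=
      (step_octopus hx).2 ⟨(mem_labels hx).1 (List.getElem_mem hi), rfl⟩
    obtain ⟨hlt, heq⟩ := List.getElem?_eq_some_iff.1 (labels_portNum hstep)
    exact ⟨_, _, hstep, (nodup_labels hx).getElem_inj_iff.1 heq⟩

theorem portNum_bijOn (x : {x // L.Valid x}) :
    Set.BijOn (fun y : {x // L.Valid x} => L.portNum x.1 y.1) {y | ∃ a, L.step a x.1 y.1}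
      (Set.Iio (L.labels x.1).length) := by
  refine ⟨fun y ⟨_, h⟩ => portNum_lt h, ?_, fun i hi => ?_⟩
  · exact fun y ⟨_, hy⟩ z ⟨_, hz⟩ h => Subtype.ext (portNum_injective hy hz h)
  · obtain ⟨a, y, hstep, hport⟩ := exists_portNum_eq hi
    exact ⟨⟨y, (hasReverse_of_step x.2 hstep).1⟩, ⟨a, hstep⟩, hport⟩

theorem finite_valid (v : V) : {tk : ℕ × ℕ | L.Valid (v, tk)}.Finite := by
  refine ((Set.finite_Iic (L.deg v)).biUnion fun t _ =>
    (Set.finite_Iio (2 ^ L.height v t)).image (Prod.mk t)).subset ?_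
  rintro ⟨t, k⟩ (⟨-, -, ht, -, hk⟩ | ⟨-, ht, hk⟩)
  · exact Set.mem_biUnion ht ⟨k, hk, rfl⟩
  · obtain ⟨rfl : t = 0, rfl : k = 0⟩ := And.intro ht hk
    exact Set.mem_biUnion (Set.mem_Iic.2 (Nat.zero_le _)) ⟨0, Nat.two_pow_pos _, rfl⟩

instance [Finite V] : Finite {x // L.Valid x} := by
  have (v : V) : Finite {tk : ℕ × ℕ // L.Valid (v, tk)} := finite_valid v
  exact Finite.of_equiv _ (Equiv.subtypeProdEquivSigmaSubtype fun v tk => L.Valid (v, tk)).symm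

theorem card_valid [Fintype V] :
    Nat.card {x // L.Valid x} = ∑ v, {tk : ℕ × ℕ | L.Valid (v, tk)}.ncard := by
  have (v : V) : Finite {tk : ℕ × ℕ // L.Valid (v, tk)} := finite_valid v
  rw [Nat.card_congr (Equiv.subtypeProdEquivSigmaSubtype fun v tk => L.Valid (v, tk)),
    Nat.card_sigma]
  rfl

theorem ncard_valid_inter {v : V} (hv : ¬ L.white v) :
    {tk : ℕ × ℕ | L.Valid (v, tk)}.ncard = 1 := by
  rw [Set.ncard_eq_one]
  refine ⟨(0, 0), Set.ext fun ⟨t, k⟩ => ?_⟩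
  simp [Valid, hv]

theorem ncard_valid_octopus {v : V} (hwhite : L.white v) (hdeg : 0 < L.deg v) :
    {tk : ℕ × ℕ | L.Valid (v, tk)}.ncard =
      ∑ t ∈ Finset.range (L.deg v + 1), (2 ^ L.height v t - 1) := by
  have hset : {tk : ℕ × ℕ | L.Valid (v, tk)} = (((Finset.range (L.deg v + 1)).sigma fun t =>
      Finset.Ico 1 (2 ^ L.height v t)).map (Equiv.sigmaEquivProd ℕ ℕ).toEmbedding : Set _) := by
    ext ⟨t, k⟩
    simp [Valid, hwhite, hdeg, Nat.one_le_iff_ne_zero]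
  rw [hset, Set.ncard_coe_finset, Finset.card_map, Finset.card_sigma]
  simp only [Nat.card_Ico]

variable (L) in
/-- The network with underlying labeled graph `L.gadgetGraph` and the given identifiers. -/
noncomputable def network [Finite V] (c : ℕ) (id : {x // L.Valid x} → ℕ)
    (hid : Function.Injective id)
    (hmem : ∀ x, id x ∈ Set.Icc 1 (Nat.card {x // L.Valid x} ^ c)) :
    Network c NodeKind HalfKind where
  V := {x // L.Valid x}
  fintypeV := Fintype.ofFinite _
  graph :=
    { Adj := fun x y => ∃ a, L.step a x.1 y.1
      symm := ⟨fun x _ ⟨_, ha⟩ =>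
        let ⟨b, hb, _⟩ := (hasReverse_of_step x.2 ha).2
        ⟨b, hb⟩⟩
      loopless := ⟨fun _ ⟨_, ha⟩ => not_step_self ha⟩ }
  ident := id
  ident_injective := hid
  ident_mem v := by
    rw [← @Nat.card_eq_fintype_card _ (_)]
    exact hmem v
  label x := kind x.1
  halfLabels x := L.labels x.1
  port x y := L.portNum x.1 y.1
  port_bijOn := portNum_bijOn

section Network

variable [Finite V] {c : ℕ} {id : {x // L.Valid x} → ℕ} {hid : Function.Injective id}
  {hmem : ∀ x, id x ∈ Set.Icc 1 (Nat.card {x // L.Valid x} ^ c)}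

theorem size_network : (L.network c id hid hmem).size = Nat.card {x // L.Valid x} :=
  (@Nat.card_eq_fintype_card _ (_)).symm

theorem gadgetGraph_network : (L.network c id hid hmem).gadgetGraph = L.gadgetGraph := by
  refine congrArg (GadgetGraph.mk _) ?_
  funext a x y
  refine propext ⟨fun ⟨⟨b, hb⟩, h⟩ => ?_, fun h => ⟨⟨a, h⟩, labels_portNum h⟩⟩
  obtain rfl := Option.some.inj ((labels_portNum hb).symm.trans h)
  exact hb

theorem network_mem_promise {S : Type} (P : LinearizableProblem S)
    (hL : ∀ v, ¬ L.white v → L.deg v ∈ P.sizes) :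
    L.network c id hid hmem ∈ (P.promise c).inputs := by
  refine ⟨fun u => ?_, fun (x : {x // L.Valid x}) hx => ?_⟩
  · rw [gadgetGraph_network]
    exact locallyOK u
  · suffices h : (L.labels x.1).length ∈ P.sizes from
      (Network.degree_eq_length (L.network c id hid hmem) x).symm ▸ h
    obtain ⟨⟨v, t, k⟩, hv⟩ := x
    obtain rfl : k = 0 := by
      by_contra hk
      exact kind_ne_inter hk hx
    simpa [labels] using hL v hv.inter.1

end Network

/-! ### Disjoint unions and stars -/

/-- The disjoint union of two layouts. -/
def sum {V' : Type} (L : Layout V) (L' : Layout V') : Layout (V ⊕ V') where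
  white := Sum.elim L.white L'.white
  deg := Sum.elim L.deg L'.deg
  nbr := Sum.elim (fun v i => .inl (L.nbr v i)) (fun v i => .inr (L'.nbr v i))
  back := Sum.elim L.back L'.back
  portHeight := Sum.elim L.portHeight L'.portHeight
  portHeight_pos := Sum.rec L.portHeight_pos L'.portHeight_pos
  white_nbr := Sum.rec L.white_nbr L'.white_nbr
  back_lt := Sum.rec L.back_lt L'.back_lt
  nbr_back := Sum.rec (fun v i h => congrArg Sum.inl (L.nbr_back v i h))
    (fun v i h => congrArg Sum.inr (L'.nbr_back v i h))
  back_back := Sum.rec L.back_back L'.back_back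

section Sum

variable {V' : Type} {L' : Layout V'}

theorem height_sum_inl (v : V) (t : ℕ) : (L.sum L').height (.inl v) t = L.height v t := by
  cases t <;> rfl

theorem height_sum_inr (v : V') (t : ℕ) : (L.sum L').height (.inr v) t = L'.height v t := by
  cases t <;> rfl

theorem valid_sum_inl {v : V} {tk : ℕ × ℕ} : (L.sum L').Valid (.inl v, tk) ↔ L.Valid (v, tk) := by
  simp only [Valid, height_sum_inl]; rfl

theorem valid_sum_inr {v : V'} {tk : ℕ × ℕ} :
    (L.sum L').Valid (.inr v, tk) ↔ L'.Valid (v, tk) := by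
  simp only [Valid, height_sum_inr]; rfl

theorem card_valid_sum [Finite V] [Finite V'] :
    Nat.card {x // (L.sum L').Valid x} =
      Nat.card {x // L.Valid x} + Nat.card {x // L'.Valid x} := by
  have := Fintype.ofFinite V
  have := Fintype.ofFinite V'
  simp only [card_valid, Fintype.sum_sum_type, valid_sum_inl, valid_sum_inr]

end Sum

/-- A disjoint union of `m` stars, each with a black center and `d` white leaves. The first `k`
white nodes have port-gadgets of height `2`, the others of height `1`. -/
def stars (d m k : ℕ) : Layout (Fin m × Option (Fin d)) where
  white x := x.2.isSome
  deg x := x.2.elim d fun _ => 1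
  nbr x j := (x.1, x.2.elim (if h : j < d then some ⟨j, h⟩ else none) fun _ => none)
  back x _ := x.2.elim 0 fun i => i
  portHeight x := x.2.elim 1 fun i => if (finProdFinEquiv (x.1, i) : ℕ) < k then 2 else 1
  portHeight_pos := by
    rintro ⟨a, _ | b⟩
    · simp
    · simp only [Option.elim_some]; split <;> simp
  white_nbr := by
    rintro ⟨a, _ | b⟩ i hi
    · simp only [Option.elim_none] at hi; simp [hi]
    · simp
  back_lt := by
    rintro ⟨a, _ | b⟩ i hi
    · simp only [Option.elim_none] at hi; simp [hi]
    · simp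
  nbr_back := by
    rintro ⟨a, _ | b⟩ i hi
    · simp only [Option.elim_none] at hi; simp [hi]
    · simp
  back_back := by
    rintro ⟨a, _ | b⟩ i hi
    · simp only [Option.elim_none] at hi; simp [hi]
    · simp only [Option.elim_some, Nat.lt_one_iff] at hi; simp [hi]

theorem ncard_valid_stars_center {d m k : ℕ} (a : Fin m) :
    {tk : ℕ × ℕ | (stars d m k).Valid ((a, none), tk)}.ncard = 1 :=
  ncard_valid_inter (by simp [stars])

theorem ncard_valid_stars_leaf {d m k : ℕ} (a : Fin m) (b : Fin d) :
    {tk : ℕ × ℕ | (stars d m k).Valid ((a, some b), tk)}.ncard =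
      2 + if (finProdFinEquiv (a, b) : ℕ) < k then 2 else 0 := by
  rw [ncard_valid_octopus (by simp [stars]) (by simp [stars])]
  simp only [stars, Option.elim_some, Finset.sum_range_succ, Finset.sum_range_zero, height]
  split_ifs <;> simp

theorem card_valid_stars {d m k : ℕ} (hk : k ≤ m * d) :
    Nat.card {x // (stars d m k).Valid x} = m + 2 * (m * d) + 2 * k := by
  have hfilter : (Finset.range (m * d)).filter (· < k) = Finset.range k := by
    ext i; simp; omega
  simp only [card_valid, Fintype.sum_prod_type, Fintype.sum_option, ncard_valid_stars_center,
    ncard_valid_stars_leaf]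
  rw [Finset.sum_add_distrib, ← Fintype.sum_prod_type',
    finProdFinEquiv.sum_comp (fun i : Fin (m * d) => 2 + if (i : ℕ) < k then 2 else 0),
    Finset.sum_add_distrib, Fin.sum_univ_eq_sum_range (fun i => if i < k then 2 else 0),
    ← Finset.sum_filter, hfilter]
  simp only [Finset.sum_const, Finset.card_univ, Fintype.card_fin, Finset.card_range, smul_eq_mul]
  ring

-- `m` must have the parity of `R`, which one of `R / (2 * d + 1)` and its predecessor has.
theorem exists_stars {d R : ℕ} (hR : 6 * d + 3 ≤ R) :
    ∃ m k, k ≤ m * d ∧ m + 2 * (m * d) + 2 * k = R := by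
  have hdivmod := Nat.div_add_mod R (2 * d + 1)
  have hmod := Nat.mod_lt R (show 2 * d + 1 > 0 by omega)
  have hdiv : 3 ≤ R / (2 * d + 1) := by
    rw [Nat.le_div_iff_mul_le (by omega)]; omega
  obtain ⟨s, hs⟩ := Nat.exists_eq_add_of_le' hdiv
  have hexpand : (2 * d + 1) * (s + 3) = 2 * (s * d) + s + 6 * d + 3 := by ring
  rw [hs, hexpand] at hdivmod
  by_cases hparity : (R + s) % 2 = 1
  · refine ⟨s + 3, (R - (2 * (s * d) + s + 6 * d + 3)) / 2, ?_, ?_⟩ <;>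
      rw [show (s + 3) * d = s * d + 3 * d by ring] <;> omega
  · refine ⟨s + 2, (R - (2 * (s * d) + s + 4 * d + 2)) / 2, ?_, ?_⟩ <;>
      rw [show (s + 2) * d = s * d + 2 * d by ring] <;> omega

end Layout

/-! ### Decoding solutions of the promise problem -/

namespace Layout

variable {V : Type} {L : Layout V}

/-- The root of the `i`-th port-gadget of the white node `v`. -/
def root {v : V} (hv : L.white v) (i : Fin (L.deg v)) : {x // L.Valid x} :=
  ⟨(v, i + 1, 1), valid_root hv i.pos i.2⟩

/-- The leaf of the head-gadget of `v` from which the `i`-th port-gadget hangs. -/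
def leaf {v : V} (hv : L.white v) (i : Fin (L.deg v)) : {x // L.Valid x} :=
  ⟨(v, 0, leafOf (L.deg v) i), valid_leafOf hv i.2⟩

open Classical in
variable (L) in
/-- The labels of the port-gadgets of the white node `v`, from left to right. A black node decodes
to the empty list. -/
noncomputable def decode {S : Type} (y : {x // L.Valid x} → Option S) (v : V) : List S :=
  if hv : L.white v then (List.finRange (L.deg v)).filterMap fun i => y (root hv i) else []

theorem kind_leaf {v : V} (hv : L.white v) (i : Fin (L.deg v)) :
    L.gadgetGraph.kind (leaf hv i) = .head :=
  kind_octopus (v := v) (t := 0) (leafOf_ne_zero _ _)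

theorem not_has_left_leaf_zero {v : V} (hv : L.white v) (hdeg : 0 < L.deg v) :
    ¬ L.gadgetGraph.Has .left (leaf hv ⟨0, hdeg⟩) := by
  rw [has_iff (leafOf_ne_zero _ _)]
  exact not_not.2 ⟨Nat.log 2 (L.deg v), by simp [leaf, leafOf]⟩

theorem not_has_right_leaf_last {v : V} (hv : L.white v) {i : Fin (L.deg v)}
    (hi : (i : ℕ) + 1 = L.deg v) : ¬ L.gadgetGraph.Has .right (leaf hv i) := by
  rw [has_iff (leafOf_ne_zero _ _)]
  refine not_not.2 ⟨Nat.log 2 (L.deg v) + 1, ?_⟩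
  have hpow := Nat.pow_log_le_self 2 i.pos.ne'
  have hpow' := lt_two_mul_pow_log (L.deg v)
  simp only [leaf, leafOf, pow_succ]
  omega

theorem lastPort_root {v : V} (hv : L.white v) {i : Fin (L.deg v)}
    (hi : i < 2 * (L.deg v - 2 ^ Nat.log 2 (L.deg v)) → (i : ℕ) % 2 = 1) :
    L.gadgetGraph.LastPort (leaf hv i) (root hv i) := by
  by_cases htwo : i < 2 * (L.deg v - 2 ^ Nat.log 2 (L.deg v))
  · exact .inl (step_portB i.2 ⟨htwo, hi htwo⟩)
  · refine .inr ⟨step_portA i.2 fun hsecond => htwo hsecond.1, ?_⟩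
    rw [has_iff (leafOf_ne_zero _ _)]
    rintro ⟨-, -, hlt⟩
    simp only [leaf, leafOf] at hlt
    omega

theorem nextPort_root {v : V} (hv : L.white v) {i j : Fin (L.deg v)} (hij : (j : ℕ) = i + 1) :
    L.gadgetGraph.NextPort (root hv i) (root hv j) := by
  have hj := j.2
  refine ⟨leaf hv i, ?_⟩
  by_cases hfirst : i < 2 * (L.deg v - 2 ^ Nat.log 2 (L.deg v)) ∧ (i : ℕ) % 2 = 0
  · have hleaf : leaf hv i = leaf hv j := by
      simp only [leaf, leafOf, Subtype.mk.injEq, Prod.mk.injEq, true_and]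
      omega
    refine .inl ⟨step_portA i.2 fun hsecond => by have := hsecond.2; omega, ?_⟩
    rw [hleaf]
    exact step_portB j.2 ⟨by omega, by omega⟩
  · refine .inr ⟨leaf hv j, ?_, lastPort_root hv (by omega),
      step_portA j.2 fun ⟨_, _⟩ => by omega⟩
    have hleaf : leafOf (L.deg v) j = leafOf (L.deg v) i + 1 := by
      simp only [leafOf]; omega
    refine (step_octopus (leafOf_ne_zero _ _)).2 ⟨?_, by simp only [target, leaf, hleaf]⟩
    refine not_isPowerOfTwo_of_lt (e := Nat.log 2 (L.deg v)) ?_ ?_ <;>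
      simp only [leaf, ← hleaf]
    · exact hleaf ▸ Nat.lt_succ_of_le (pow_log_le_leafOf _ _)
    · exact leafOf_lt hj

theorem inwardTarget_injective {b : V} {i j : ℕ} (hi : i < L.deg b) (hj : j < L.deg b)
    (h : L.inwardTarget b i = L.inwardTarget b j) : i = j := by
  rw [← portNum_inwardTarget (t := 0) hi, h, portNum_inwardTarget hj]

section PromiseSolution

variable {S : Type} {P : LinearizableProblem S} [Finite V] {y : {x // L.Valid x} → Option S}

theorem label_eq_root (hy : L.gadgetGraph.PromiseSolution P y) {v : V} (hv : L.white v)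
    (i : Fin (L.deg v)) {k : ℕ} (h : L.Valid (v, i + 1, k)) : y ⟨_, h⟩ = y (root hv i) := by
  induction k using Nat.strong_induction_on with
  | _ k ih =>
  have hport {k : ℕ} (hk : k ≠ 0) : kind (v, (i : ℕ) + 1, k) = .port := kind_octopus hk
  have hk : k ≠ 0 := by
    rintro rfl
    exact Nat.succ_ne_zero _ h.inter.2
  rcases eq_or_ne k 1 with rfl | hk1
  · rfl
  have hstep : L.step .parent (v, i + 1, k) (v, i + 1, k / 2) :=
    (step_octopus hk).2 ⟨show 2 ≤ k by omega, rfl⟩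
  have hparent := (hasReverse_of_step h hstep).1
  rw [← ih (k / 2) (by omega) hparent]
  exact hy.const .parent _ _ (hport hk) (hport (by omega)) hstep

theorem exists_decode_eq_ofFn (hy : L.gadgetGraph.PromiseSolution P y) {v : V}
    (hv : L.white v) : ∃ f : Fin (L.deg v) → S, L.decode y v = List.ofFn f ∧
      ∀ i, y (root hv i) = some (f i) := by
  have hlab (i : Fin (L.deg v)) : ∃ s, y (root hv i) = some s :=
    hy.lab _ (kind_octopus (v := v) (t := i + 1) one_ne_zero)
  choose f hf using hlab
  refine ⟨f, ?_, hf⟩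
  simp only [decode, dif_pos hv, hf, List.ofFn_eq_map, ← List.filterMap_eq_map, Function.comp_def]

theorem length_decode (hy : L.gadgetGraph.PromiseSolution P y) {v : V} (hv : L.white v) :
    (L.decode y v).length = L.deg v := by
  obtain ⟨f, hf, -⟩ := exists_decode_eq_ofFn hy hv
  rw [hf, List.length_ofFn]

theorem head?_decode_mem (hy : L.gadgetGraph.PromiseSolution P y) {v : V} (hv : L.white v) :
    ∀ s ∈ (L.decode y v).head?, s ∈ P.first := by
  obtain ⟨f, hf, hroot⟩ := exists_decode_eq_ofFn hy hv
  intro s hs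
  obtain ⟨hdeg, hs⟩ : ∃ hdeg : 0 < L.deg v, f ⟨0, hdeg⟩ = s := by
    simpa [hf, List.head?_eq_getElem?, List.getElem?_eq_some_iff] using hs
  have hstep : L.gadgetGraph.step .portA (leaf hv ⟨0, hdeg⟩) (root hv ⟨0, hdeg⟩) :=
    step_portA hdeg fun hsecond => Nat.zero_ne_one hsecond.2
  obtain ⟨t, ht, hyt⟩ := hy.first _ _ (kind_leaf hv _) (not_has_left_leaf_zero hv hdeg) hstep
  obtain rfl : f ⟨0, hdeg⟩ = t := Option.some.inj ((hroot _).symm.trans hyt)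
  exact hs ▸ ht

theorem getLast?_decode_mem (hy : L.gadgetGraph.PromiseSolution P y) {v : V} (hv : L.white v) :
    ∀ s ∈ (L.decode y v).getLast?, s ∈ P.last := by
  obtain ⟨f, hf, hroot⟩ := exists_decode_eq_ofFn hy hv
  intro s hs
  obtain ⟨hdeg, hs⟩ : ∃ hdeg : L.deg v - 1 < L.deg v, f ⟨L.deg v - 1, hdeg⟩ = s := by
    simpa [hf, List.getLast?_eq_getElem?, List.getElem?_eq_some_iff] using hs
  have hpow := Nat.pow_log_le_self 2 (Nat.ne_zero_of_lt hdeg)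
  have hpow' := lt_two_mul_pow_log (L.deg v)
  obtain ⟨t, ht, hyt⟩ := hy.last _ _ (kind_leaf hv ⟨_, hdeg⟩)
    (not_has_right_leaf_last hv (Nat.sub_add_cancel (Nat.zero_lt_of_lt hdeg)))
    (lastPort_root hv (by dsimp only; omega))
  obtain rfl : f ⟨_, hdeg⟩ = t := Option.some.inj ((hroot _).symm.trans hyt)
  exact hs ▸ ht

theorem isChain_decode (hy : L.gadgetGraph.PromiseSolution P y) {v : V} (hv : L.white v) :
    (L.decode y v).IsChain fun s t => (s, t) ∈ P.pairs := by
  obtain ⟨f, hf, hroot⟩ := exists_decode_eq_ofFn hy hv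
  rw [hf, List.isChain_iff_getElem]
  intro i hi
  have hi : i + 1 < L.deg v := by simpa using hi
  obtain ⟨s, t, hst, hs, ht⟩ :=
    hy.pairs _ _ (nextPort_root hv (i := ⟨i, Nat.lt_of_succ_lt hi⟩) (j := ⟨i + 1, hi⟩) rfl)
  rw [hroot, Option.some.injEq] at hs ht
  simpa [hs, ht] using hst

theorem getElem?_decode (hy : L.gadgetGraph.PromiseSolution P y) {v : V} (hv : L.white v) {i : ℕ}
    (hi : i < L.deg v) {k : ℕ} (h : L.Valid (v, i + 1, k)) :
    (L.decode y v)[i]? = y ⟨_, h⟩ := by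
  obtain ⟨f, hf, hroot⟩ := exists_decode_eq_ofFn hy hv
  rw [label_eq_root hy hv ⟨i, hi⟩ h, hroot, hf]
  simp [hi]

theorem exists_black_multiset_decode (hy : L.gadgetGraph.PromiseSolution P y) {b : V}
    (hb : ¬ L.white b) (hdeg : L.deg b ∈ P.sizes) :
    ∃ m ∈ P.black, Finset.univ.val.map
      (fun j : Fin (L.deg b) => (L.decode y (L.nbr b j))[L.back b j]?) = m.map some := by
  classical
  let entry (j : Fin (L.deg b)) : {x // L.Valid x} := ⟨_, valid_inwardTarget hb j.2⟩
  have hentry : Function.Injective entry := fun i j h =>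
    Fin.ext (inwardTarget_injective i.2 j.2 (congrArg Subtype.val h))
  have hset : entry '' Set.univ = {w | L.gadgetGraph.step .inward ⟨_, valid_inter hb⟩ w} := by
    ext w
    rw [Set.image_univ, Set.mem_range, Set.mem_ofPred_eq]
    constructor
    · rintro ⟨j, rfl⟩
      exact (step_inter rfl).2 ⟨rfl, j, j.2, rfl⟩
    · intro h
      obtain ⟨-, j, hj, h⟩ := (step_inter rfl).1 h
      exact ⟨⟨j, hj⟩, Subtype.ext h.symm⟩
  obtain ⟨m, hm, heq⟩ := hy.black ⟨_, valid_inter hb⟩ (kind_inter (v := b) (t := 0)) (by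
    rw [← hset, Set.ncard_image_of_injective _ hentry]
    simpa [Set.ncard_univ] using hdeg)
  refine ⟨m, hm, ?_⟩
  rw [← heq, toFinset_image_val_map hentry.injOn hset, Set.Finite.toFinset_univ]
  exact Multiset.map_congr rfl fun j _ =>
    getElem?_decode hy ((L.white_nbr b j j.2).2 hb) (L.back_lt b j j.2) _

end PromiseSolution

end Layout

/-! ### Replacing white nodes by octopus gadgets -/

theorem exists_injective_extension {α : Type*} [Finite α] {f : α → ℕ} {s : Set α} {B : ℕ}
    (hf : Set.InjOn f s) (hs : Set.MapsTo f s (Set.Icc 1 B)) (hB : Nat.card α ≤ B) :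
    ∃ g : α → ℕ, Function.Injective g ∧ (∀ x, g x ∈ Set.Icc 1 B) ∧ Set.EqOn g f s := by
  classical
  have := Fintype.ofFinite α
  obtain ⟨t, hst, htB, ht⟩ := Finset.exists_subsuperset_card_eq (s := s.toFinset.image f)
    (t := Finset.Icc 1 B) (n := Fintype.card α)
    (fun x hx => by
      obtain ⟨a, ha, rfl⟩ := Finset.mem_image.1 hx
      exact Finset.mem_Icc.2 (hs (Set.mem_toFinset.1 ha)))
    (Finset.card_image_le.trans (Finset.card_le_univ _))
    (by simpa [Nat.card_eq_fintype_card] using hB)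
  obtain ⟨g, hg⟩ := Finset.exists_equiv_extend_of_card_eq ht.symm hst (by simpa using hf)
  exact ⟨fun x => g x, fun x y h => g.injective (Subtype.ext h),
    fun x => Finset.mem_Icc.1 (htB (g x).2), fun x hx => hg x (Set.mem_toFinset.2 hx)⟩

theorem mul_add_inj_of_lt {K a b x y : ℕ} (hx : x < K) (hy : y < K)
    (h : a * K + x = b * K + y) : a = b ∧ x = y := by
  have hdiv := congrArg (· / K) h
  simp only [mul_comm _ K, Nat.mul_add_div (Nat.zero_lt_of_lt hx), Nat.div_eq_of_lt hx,
    Nat.div_eq_of_lt hy, add_zero] at hdiv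
  subst hdiv
  exact ⟨rfl, Nat.add_left_cancel h⟩

theorem Color.eq_white_iff_of_ne {a b : Color} (h : a ≠ b) : a = .white ↔ ¬ b = .white := by
  cases a <;> cases b <;> simp_all

theorem Color.eq_black_of_ne_white {a : Color} (h : ¬ a = .white) : a = .black := by
  cases a <;> simp_all

namespace Network

section Nbr

variable {c : ℕ} {X Y : Type} (N : Network c X Y)

open Classical in
/-- The neighbor of `v` at its port `i`, or the junk value `v` if there is no such port. -/
noncomputable def nbr (v : N.V) (i : ℕ) : N.V :=
  if h : ∃ w, N.graph.Adj v w ∧ N.port v w = i then h.choose else v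

theorem nbr_spec {v : N.V} {i : ℕ} (hi : i < (N.halfLabels v).length) :
    N.graph.Adj v (N.nbr v i) ∧ N.port v (N.nbr v i) = i := by
  have h : ∃ w, N.graph.Adj v w ∧ N.port v w = i := (N.port_bijOn v).surjOn hi
  rw [nbr, dif_pos h]
  exact h.choose_spec

theorem nbr_port {v w : N.V} (h : N.graph.Adj v w) : N.nbr v (N.port v w) = w :=
  have hspec := N.nbr_spec (N.port_lt h)
  (N.port_bijOn v).injOn hspec.1 h hspec.2

theorem nbr_injective (v : N.V) :
    Function.Injective fun i : Fin (N.halfLabels v).length => N.nbr v i := fun i j hij =>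
  Fin.ext ((N.nbr_spec i.2).2.symm.trans ((congrArg (N.port v) hij).trans (N.nbr_spec j.2).2))

theorem range_nbr (v : N.V) :
    (Set.range fun i : Fin (N.halfLabels v).length => N.nbr v i) = N.graph.neighborSet v := by
  refine Set.Subset.antisymm (Set.range_subset_iff.2 fun i => (N.nbr_spec i.2).1) fun w hw => ?_
  exact ⟨⟨N.port v w, N.port_lt hw⟩, N.nbr_port hw⟩

theorem length_halfLabels_le (v : N.V) : (N.halfLabels v).length ≤ N.size := by
  rw [← N.degree_eq_length, degree, size, ← Nat.card_eq_fintype_card]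
  exact Set.ncard_le_card _

end Nbr

variable {c : ℕ}

/-- The node labels form a proper coloring, which makes the network the incidence graph of a
hypergraph. -/
def ProperlyColored (N : Network c Color Unit) : Prop :=
  ∀ u w, N.graph.Adj u w → N.label u ≠ N.label w

variable {N : Network c Color Unit} {hN : N.ProperlyColored} {h : ℕ} [NeZero h]

variable (N h) in
/-- The layout that turns the white nodes of a network into octopus gadgets with port-gadgets of
height `h`. -/
noncomputable def layout (hN : N.ProperlyColored) : Layout N.V where
  white v := N.label v = .white
  deg v := (N.halfLabels v).length
  nbr := N.nbr
  back v i := N.port (N.nbr v i) v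
  portHeight _ := h
  portHeight_pos _ := NeZero.pos h
  white_nbr v i hi := Color.eq_white_iff_of_ne (hN _ _ (N.nbr_spec hi).1.symm)
  back_lt v i hi := N.port_lt (N.nbr_spec hi).1.symm
  nbr_back v i hi := N.nbr_port (N.nbr_spec hi).1.symm
  back_back v i hi := by
    rw [N.nbr_port (N.nbr_spec hi).1.symm, (N.nbr_spec hi).2]

theorem exists_black_multiset_decode {S V' : Type} {P : LinearizableProblem S} [Finite V']
    {L' : Layout V'} {y : {x // ((N.layout h hN).sum L').Valid x} → Option S}
    (hy : ((N.layout h hN).sum L').gadgetGraph.PromiseSolution P y) {u : N.V}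
    (hu : N.label u = .black) (hdeg : N.degree u ∈ P.sizes) :
    ∃ m ∈ P.black, (Set.toFinite (N.graph.neighborSet u)).toFinset.val.map
      (fun v => (((N.layout h hN).sum L').decode y (.inl v))[N.port v u]?) = m.map some := by
  have hblack : ¬ N.label u = .white := by simp [hu]
  rw [N.degree_eq_length] at hdeg
  obtain ⟨m, hm, heq⟩ := Layout.exists_black_multiset_decode hy (b := .inl u) hblack hdeg
  refine ⟨m, hm, ?_⟩
  rw [← heq, toFinset_image_val_map (N.nbr_injective u).injOn
    (Set.image_univ.trans (N.range_nbr u)), Set.Finite.toFinset_univ]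
  rfl

theorem decode_solution {S V' : Type} {P : LinearizableProblem S} [Finite V'] {L' : Layout V'}
    (hNP : N ∈ (P.problem c).inputs) {y : {x // ((N.layout h hN).sum L').Valid x} → Option S}
    (hy : ((N.layout h hN).sum L').gadgetGraph.PromiseSolution P y) :
    (P.problem c).Solution N fun v => ((N.layout h hN).sum L').decode y (.inl v) := by
  refine ⟨fun v hv => ⟨?_, ?_, ?_, ?_⟩, fun u hu => ⟨?_, ?_⟩⟩
  · rw [N.degree_eq_length]
    exact Layout.length_decode hy (v := .inl v) hv
  · exact Layout.head?_decode_mem hy (v := .inl v) hv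
  · exact Layout.getLast?_decode_mem hy (v := .inl v) hv
  · exact Layout.isChain_decode hy (v := .inl v) hv
  · exact dif_neg (show ¬ N.label u = .white by simp [hu])
  · exact exists_black_multiset_decode hy hu (hNP.2 u hu)

/-- The position of the node `tk` of an octopus gadget in the block of identifiers reserved for this
gadget. The first `2 * n` positions are for the head-gadget, and every port-gadget gets the next
`2 ^ h` positions. -/
def blockOffset (n h : ℕ) (tk : ℕ × ℕ) : ℕ :=
  if tk.1 = 0 then tk.2 else 2 * n + (tk.1 - 1) * 2 ^ h + tk.2

/-- The number of identifiers reserved for each node of an `n`-node network. -/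
def blockSize (n h : ℕ) : ℕ := n * (2 ^ h + 2)

theorem lt_of_valid_layout_head {v : N.V} {k : ℕ} (hk : (N.layout h hN).Valid (v, 0, k)) :
    k < 2 * N.size := by
  have hn : 0 < N.size := Fintype.card_pos_iff.2 ⟨v⟩
  rcases eq_or_ne k 0 with rfl | hk0
  · omega
  · obtain ⟨-, hdeg, -, hlt⟩ := hk.octopus hk0
    have hpow := Nat.pow_log_le_self 2 hdeg.ne'
    have hle : (N.layout h hN).deg v ≤ N.size := N.length_halfLabels_le v
    simp only [Layout.height, pow_succ] at hlt
    omega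

theorem lt_of_valid_layout_port {v : N.V} {i k : ℕ}
    (hk : (N.layout h hN).Valid (v, i + 1, k)) : i < N.size ∧ k < 2 ^ h := by
  have hk0 : k ≠ 0 := by
    rintro rfl
    exact Nat.succ_ne_zero _ hk.inter.2
  obtain ⟨-, -, hi, hlt⟩ := hk.octopus hk0
  exact ⟨hi.trans (N.length_halfLabels_le v), hlt⟩

theorem blockOffset_lt {v : N.V} {tk : ℕ × ℕ} (hv : (N.layout h hN).Valid (v, tk)) :
    blockOffset N.size h tk < blockSize N.size h := by
  obtain ⟨_ | i, k⟩ := tk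
  · have hk := lt_of_valid_layout_head hv
    simp only [blockOffset, blockSize, if_true]
    nlinarith [Nat.zero_le (N.size * 2 ^ h)]
  · obtain ⟨hi, hk⟩ := lt_of_valid_layout_port hv
    have hmul : (i + 1) * 2 ^ h ≤ N.size * 2 ^ h := Nat.mul_le_mul_right _ hi
    simp only [blockOffset, blockSize, Nat.add_sub_cancel, Nat.succ_ne_zero, if_false]
    linarith

theorem blockOffset_injective {v : N.V} {tk tk' : ℕ × ℕ} (hv : (N.layout h hN).Valid (v, tk))
    (hv' : (N.layout h hN).Valid (v, tk'))
    (heq : blockOffset N.size h tk = blockOffset N.size h tk') : tk = tk' := by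
  obtain ⟨_ | i, k⟩ := tk <;> obtain ⟨_ | i', k'⟩ := tk' <;>
    simp only [blockOffset, Nat.add_sub_cancel, Nat.succ_ne_zero, if_false, if_true] at heq
  · rw [heq]
  · have := lt_of_valid_layout_head hv
    omega
  · have := lt_of_valid_layout_head hv'
    omega
  · have hsum : i * 2 ^ h + k = i' * 2 ^ h + k' := by linarith
    obtain ⟨rfl, rfl⟩ :=
      mul_add_inj_of_lt (lt_of_valid_layout_port hv).2 (lt_of_valid_layout_port hv').2 hsum
    rfl

theorem card_valid_layout_le :
    Nat.card {x // (N.layout h hN).Valid x} ≤ N.size * blockSize N.size h := by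
  rw [Layout.card_valid]
  refine Finset.sum_le_card_nsmul _ _ (blockSize N.size h) fun v _ => ?_
  have hle := Set.ncard_le_ncard_of_injOn (s := {tk | (N.layout h hN).Valid (v, tk)})
    (t := Set.Iio (blockSize N.size h)) (blockOffset N.size h) (fun _ => blockOffset_lt)
    (fun _ htk _ htk' => blockOffset_injective htk htk') (Set.finite_Iio _)
  simpa using hle

variable (N h) in
/-- The identifier of the node `tk` of the octopus gadget of `v`. The gadgets get disjoint blocks of
consecutive identifiers, and only `N.size` and the identifier of `v` matter. -/
def blockIdent (v : N.V) (tk : ℕ × ℕ) : ℕ :=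
  (N.ident v - 1) * blockSize N.size h + blockOffset N.size h tk + 1

theorem blockIdent_injective {v w : N.V} {tk tk' : ℕ × ℕ} (hv : (N.layout h hN).Valid (v, tk))
    (hw : (N.layout h hN).Valid (w, tk')) (heq : N.blockIdent h v tk = N.blockIdent h w tk') :
    v = w ∧ tk = tk' := by
  obtain ⟨hident, hoffset⟩ := mul_add_inj_of_lt (blockOffset_lt hv) (blockOffset_lt hw)
    (Nat.add_right_cancel heq)
  have hv1 := (N.ident_mem v).1
  have hw1 := (N.ident_mem w).1
  obtain rfl := N.ident_injective (show N.ident v = N.ident w by omega)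
  exact ⟨rfl, blockOffset_injective hv hw hoffset⟩

theorem blockIdent_mem (hc : c ≠ 0) {M : ℕ} (hM : N.size * blockSize N.size h ≤ M) {v : N.V}
    {tk : ℕ × ℕ} (hv : (N.layout h hN).Valid (v, tk)) :
    N.blockIdent h v tk ∈ Set.Icc 1 (M ^ c) := by
  refine ⟨Nat.succ_le_succ (Nat.zero_le _), ?_⟩
  obtain ⟨i, hi⟩ := Nat.exists_eq_add_of_le' (N.ident_mem v).1
  calc N.blockIdent h v tk ≤ N.ident v * blockSize N.size h := by
        have := blockOffset_lt hv
        simp only [blockIdent, hi, Nat.add_sub_cancel]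
        linarith
    _ ≤ N.size ^ c * blockSize N.size h := Nat.mul_le_mul_right _ (N.ident_mem v).2
    _ ≤ N.size ^ c * blockSize N.size h ^ c := Nat.mul_le_mul_left _ (Nat.le_self_pow hc _)
    _ = (N.size * blockSize N.size h) ^ c := (mul_pow _ _ _).symm
    _ ≤ M ^ c := Nat.pow_le_pow_left hM _

/-- A proper instance with `M` nodes into which the bipartite network `N` has been turned: every
white node is replaced by an octopus gadget with port-gadgets of height `h`, and `m` stars with
hyperedges of size `d` are added to reach the required number of nodes. -/
structure GadgetLift (N : Network c Color Unit) (hN : N.ProperlyColored) (h : ℕ) [NeZero h]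
    (d M : ℕ) where
  m : ℕ
  k : ℕ
  card_eq : Nat.card {x // ((N.layout h hN).sum (Layout.stars d m k)).Valid x} = M
  id : {x // ((N.layout h hN).sum (Layout.stars d m k)).Valid x} → ℕ
  id_injective : Function.Injective id
  id_mem : ∀ x, id x ∈ Set.Icc 1 (M ^ c)
  id_eq : ∀ v tk hv, id ⟨(.inl v, tk), hv⟩ = N.blockIdent h v tk

theorem nonempty_gadgetLift (hc : c ≠ 0) {d M : ℕ}
    (hM : N.size * blockSize N.size h + (6 * d + 3) ≤ M) :
    Nonempty (N.GadgetLift hN h d M) := by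
  have hle := card_valid_layout_le (hN := hN) (h := h)
  obtain ⟨m, k, hkm, hstars⟩ := Layout.exists_stars
    (show 6 * d + 3 ≤ M - Nat.card {x // (N.layout h hN).Valid x} by omega)
  have hcard : Nat.card {x // ((N.layout h hN).sum (Layout.stars d m k)).Valid x} = M := by
    rw [Layout.card_valid_sum, Layout.card_valid_stars hkm, hstars]
    omega
  let f (x : {x // ((N.layout h hN).sum (Layout.stars d m k)).Valid x}) : ℕ :=
    x.1.1.elim (fun v => N.blockIdent h v x.1.2) fun _ => 0
  have hinj : Set.InjOn f {x | x.1.1.isLeft} := by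
    rintro ⟨⟨v | v, tk⟩, hv⟩ hvl ⟨⟨w | w, tk'⟩, hw⟩ hwl heq
    · obtain ⟨rfl, rfl⟩ :=
        blockIdent_injective (Layout.valid_sum_inl.1 hv) (Layout.valid_sum_inl.1 hw) heq
      rfl
    all_goals simp at hvl hwl
  have hmaps : Set.MapsTo f {x | x.1.1.isLeft} (Set.Icc 1 (M ^ c)) := by
    rintro ⟨⟨v | v, tk⟩, hv⟩ hvl
    · exact blockIdent_mem hc (by omega) (Layout.valid_sum_inl.1 hv)
    · simp at hvl
  obtain ⟨id, hid, hmem, heq⟩ :=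
    exists_injective_extension hinj hmaps (hcard.le.trans (Nat.le_self_pow hc M))
  exact ⟨⟨m, k, hcard, id, hid, hmem, fun v tk hv => heq (x := ⟨(.inl v, tk), hv⟩) rfl⟩⟩

namespace GadgetLift

variable {d M : ℕ} (D : N.GadgetLift hN h d M)

/-- The layout of the proper instance. -/
noncomputable abbrev layout : Layout (N.V ⊕ Fin D.m × Option (Fin d)) :=
  (N.layout h hN).sum (Layout.stars d D.m D.k)

/-- The proper instance as a network. -/
noncomputable def network : Network c NodeKind HalfKind :=
  D.layout.network c D.id D.id_injective fun x => D.card_eq.symm ▸ D.id_mem x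

theorem size_network : D.network.size = M := Layout.size_network.trans D.card_eq

theorem network_mem {S : Type} {P : LinearizableProblem S} (hNP : N ∈ (P.problem c).inputs)
    (hd : d ∈ P.sizes) : D.network ∈ (P.promise c).inputs := by
  refine Layout.network_mem_promise P ?_
  rintro (v | ⟨a, _ | b⟩) hv
  · have hdeg := hNP.2 v (Color.eq_black_of_ne_white hv)
    rwa [N.degree_eq_length] at hdeg
  · exact hd
  · exact absurd rfl hv

/-- The output on `N` that is read off from an output on the proper instance. -/
noncomputable def decode {S : Type} (y : D.network.V → Option S) (v : N.V) : List S :=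
  D.layout.decode y (.inl v)

theorem decode_solution {S : Type} {P : LinearizableProblem S} (hNP : N ∈ (P.problem c).inputs)
    {y : D.network.V → Option S} (hy : (P.promise c).Solution D.network y) :
    (P.problem c).Solution N (D.decode y) := by
  have hgraph : D.network.gadgetGraph = D.layout.gadgetGraph := Layout.gadgetGraph_network
  have hy' : D.layout.gadgetGraph.PromiseSolution P y :=
    hgraph ▸ (hy : D.network.gadgetGraph.PromiseSolution P y)
  exact Network.decode_solution hNP hy'

end GadgetLift

end Network

/-! ### Views of gadget graphs -/

theorem finRange_map_cast {d d' : ℕ} (h : d = d') :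
    (List.finRange d).map (Fin.cast h) = List.finRange d' := by
  subst h
  exact List.map_id _

namespace Layout

variable {V V' : Type} {L : Layout V} {L' : Layout V'}

variable (L L') in
/-- The nodes `v` and `v'` agree in everything that determines the shape of their gadgets. -/
structure SameGadget (v : V) (v' : V') : Prop where
  white_iff : L.white v ↔ L'.white v'
  deg_eq : L.deg v = L'.deg v'
  portHeight_eq : L.portHeight v = L'.portHeight v'

namespace SameGadget

variable {v w : V} {v' w' : V'} (hv : SameGadget L L' v v')

include hv

theorem height_eq (t : ℕ) : L.height v t = L'.height v' t := by
  cases t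
  · simp only [height, hv.deg_eq]
  · exact hv.portHeight_eq

theorem valid_iff {tk : ℕ × ℕ} : L.Valid (v, tk) ↔ L'.Valid (v', tk) := by
  simp only [Valid, hv.white_iff, hv.deg_eq, hv.height_eq]

theorem hasHalfEdge_iff {a : HalfKind} {tk : ℕ × ℕ} :
    L.HasHalfEdge a (v, tk) ↔ L'.HasHalfEdge a (v', tk) := by
  cases a <;> simp only [HasHalfEdge, hv.height_eq, hv.deg_eq, hv.portHeight_eq]

theorem labels_eq {tk : ℕ × ℕ} : L.labels (v, tk) = L'.labels (v', tk) := by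
  simp only [labels, hv.deg_eq]
  split_ifs
  · rfl
  · exact List.filter_congr fun _ _ => decide_eq_decide.2 hv.hasHalfEdge_iff

theorem target_eq {a : HalfKind} {t k : ℕ} {tk : ℕ × ℕ} (hvalid : L.Valid (v, t, k)) (hk : k ≠ 0)
    (ha : L.HasHalfEdge a (v, t, k)) (htarget : L.target a (v, t, k) = (w, tk))
    (hself : w = v → w' = v') (hnbr : ∀ i < L.deg v, L.nbr v i = w → L'.nbr v' i = w') :
    L'.target a (v', t, k) = (w', tk) := by
  obtain ⟨-, -, ht, -⟩ := hvalid.octopus hk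
  cases a with
  | outward =>
    obtain ⟨ht0 : t ≠ 0, -⟩ := ha
    obtain ⟨hw, rfl⟩ := Prod.mk.inj htarget
    exact congrArg (·, 0, 0) (hnbr (t - 1) (by omega) hw)
  | inward => exact ha.elim
  | _ =>
    obtain ⟨rfl, rfl⟩ := Prod.mk.inj htarget
    simp only [target, hself rfl, hv.deg_eq]

theorem step_octopus {a : HalfKind} {t k : ℕ} {tk : ℕ × ℕ} (hvalid : L.Valid (v, t, k))
    (hk : k ≠ 0) (hself : w = v → w' = v')
    (hnbr : ∀ i < L.deg v, L.nbr v i = w → L'.nbr v' i = w') (h : L.step a (v, t, k) (w, tk)) :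
    L'.step a (v', t, k) (w', tk) ∧
      L.portNum (v, t, k) (w, tk) = L'.portNum (v', t, k) (w', tk) := by
  obtain ⟨ha, htarget⟩ := (Layout.step_octopus hk).1 h
  have h' : L'.step a (v', t, k) (w', tk) := (Layout.step_octopus hk).2
    ⟨hv.hasHalfEdge_iff.1 ha, (hv.target_eq hvalid hk ha htarget.symm hself hnbr).symm⟩
  obtain ⟨_, hport⟩ := List.getElem?_eq_some_iff.1 (hv.labels_eq ▸ labels_portNum h)
  obtain ⟨_, hport'⟩ := List.getElem?_eq_some_iff.1 (labels_portNum h')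
  exact ⟨h', (nodup_labels (x := (v', t, k)) hk).getElem_inj_iff.1 (hport.trans hport'.symm)⟩

theorem step_inter {a : HalfKind} {t : ℕ} {tk : ℕ × ℕ} (hw : SameGadget L L' w w')
    (hnbr : ∀ i < L.deg v, L.nbr v i = w → L'.nbr v' i = w' ∧ L'.back v' i = L.back v i)
    (h : L.step a (v, t, 0) (w, tk)) :
    L'.step a (v', t, 0) (w', tk) ∧
      L.portNum (v, t, 0) (w, tk) = L'.portNum (v', t, 0) (w', tk) := by
  obtain ⟨rfl, j, hj, htarget⟩ := (Layout.step_inter rfl).1 h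
  dsimp only at hj htarget
  obtain ⟨hnbr', hback⟩ := hnbr j hj (Prod.mk.inj htarget).1.symm
  have htarget' : (w', tk) = L'.inwardTarget v' j := by
    obtain ⟨rfl, rfl⟩ := Prod.mk.inj htarget
    simp only [inwardTarget, hnbr', hback, hw.portHeight_eq]
  have hj' : j < L'.deg v' := hv.deg_eq ▸ hj
  refine ⟨(Layout.step_inter rfl).2 ⟨rfl, j, hj', htarget'⟩, ?_⟩
  rw [htarget, htarget', portNum_inwardTarget hj, portNum_inwardTarget hj']

theorem decode_eq {S : Type} {y : {x // L.Valid x} → Option S} {y' : {x // L'.Valid x} → Option S}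
    (h : ∀ i hi hi', y ⟨(v, i + 1, 1), hi⟩ = y' ⟨(v', i + 1, 1), hi'⟩) :
    L.decode y v = L'.decode y' v' := by
  by_cases hwhite : L.white v
  · have hwhite' := hv.white_iff.1 hwhite
    rw [decode, decode, dif_pos hwhite, dif_pos hwhite', ← finRange_map_cast hv.deg_eq,
      List.filterMap_map]
    exact List.filterMap_congr fun i _ => h i _ _
  · rw [decode, decode, dif_neg hwhite, dif_neg (hv.white_iff.not.1 hwhite)]

end SameGadget

end Layout

namespace Network

section Ball

variable {c : ℕ} {X Y : Type} {G H : Network c X Y} {A : Set G.V} {B : Set H.V} {s T : ℕ}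

theorem mem_ball_zero {v : G.V} : v ∈ G.ball A 0 ↔ v ∈ A := by
  simp only [ball, Nat.cast_zero, nonpos_iff_eq_zero, SimpleGraph.edist_eq_zero_iff,
    Set.mem_ofPred_eq, exists_eq_right]

theorem ball_mono (h : s ≤ T) : G.ball A s ⊆ G.ball A T :=
  fun _ ⟨a, ha, hv⟩ => ⟨a, ha, hv.trans (Nat.cast_le.2 h)⟩

theorem ball_subset_ball {A' : Set G.V} (h : A ⊆ A') : G.ball A s ⊆ G.ball A' s :=
  fun _ ⟨a, ha, hv⟩ => ⟨a, h ha, hv⟩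

theorem subset_ball : A ⊆ G.ball A s := fun _ hv =>
  ball_mono (Nat.zero_le s) (mem_ball_zero.2 hv)

theorem mem_ball_of_adj {u v : G.V} (hu : u ∈ G.ball A s) (h : G.graph.Adj u v) :
    v ∈ G.ball A (s + 1) := by
  obtain ⟨a, ha, hd⟩ := hu
  refine ⟨a, ha, SimpleGraph.edist_triangle.trans (?_ : G.graph.edist a u + G.graph.edist u v ≤ _)⟩
  rw [SimpleGraph.edist_eq_one_iff_adj.2 h, Nat.cast_succ]
  gcongr

theorem mem_ball_succ {v : G.V} :
    v ∈ G.ball A (s + 1) ↔ v ∈ G.ball A s ∨ ∃ u ∈ G.ball A s, G.graph.Adj u v := by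
  constructor
  · rintro ⟨a, ha, hd⟩
    rw [SimpleGraph.edist_comm] at hd
    obtain ⟨p, hp⟩ := SimpleGraph.exists_walk_of_edist_ne_top
      (ne_top_of_le_ne_top (ENat.natCast_ne_top _) hd)
    rw [← hp] at hd
    have hlength : p.length ≤ s + 1 := by exact_mod_cast hd
    cases p with
    | nil => exact .inl (subset_ball ha)
    | cons h q =>
      refine .inr ⟨_, ⟨a, ha, ?_⟩, h.symm⟩
      rw [SimpleGraph.edist_comm]
      exact q.edist_le.trans (Nat.cast_le.2 (Nat.le_of_succ_le_succ hlength))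
  · rintro (h | ⟨u, hu, h⟩)
    · exact ball_mono (Nat.le_succ s) h
    · exact mem_ball_of_adj hu h

theorem mem_openBall_iff {v : G.V} : v ∈ G.openBall A T ↔ ∃ s < T, v ∈ G.ball A s := by
  constructor
  · rintro ⟨a, ha, h⟩
    obtain ⟨s, hs⟩ := ENat.ne_top_iff_exists.1 (ne_top_of_lt h)
    rw [← hs] at h
    exact ⟨s, Nat.cast_lt.1 h, a, ha, hs.symm.le⟩
  · rintro ⟨s, hs, a, ha, h⟩
    exact ⟨a, ha, lt_of_le_of_lt h (Nat.cast_lt.2 hs)⟩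

theorem ViewAdj.symm {u w : G.V} (h : G.ViewAdj A T u w) : G.ViewAdj A T w u :=
  ⟨h.1.symm, h.2.2.1, h.2.1, h.2.2.2.symm⟩

theorem viewAdj_of_mem_ball (hs : s < T) {u w : G.V} (hu : u ∈ G.ball A s)
    (h : G.graph.Adj u w) : G.ViewAdj A T u w :=
  ⟨h, ball_mono hs.le hu, ball_mono hs (mem_ball_of_adj hu h),
    .inl (mem_openBall_iff.2 ⟨s, hs, hu⟩)⟩

variable {φ : G.V → H.V} {ψ : H.V → G.V}

theorem ViewIso.rightInvOn (h : ViewIso G H A B T φ) (hψ : Set.LeftInvOn ψ φ (G.ball A T)) :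
    Set.LeftInvOn φ ψ (H.ball B T) := by
  intro w hw
  obtain ⟨v, hv, rfl⟩ := h.bijOn.surjOn hw
  rw [hψ hv]

theorem ViewIso.symm (h : ViewIso G H A B T φ) (hψ : Set.LeftInvOn ψ φ (G.ball A T)) :
    ViewIso H G B A T ψ := by
  have hφ := h.rightInvOn hψ
  have hbij : Set.BijOn ψ (H.ball B T) (G.ball A T) := h.bijOn.symm ⟨hφ, hψ⟩
  have hadj (u) (hu : u ∈ H.ball B T) (w) (hw : w ∈ H.ball B T) :
      H.ViewAdj B T u w ↔ G.ViewAdj A T (ψ u) (ψ w) := by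
    rw [h.adj_iff _ (hbij.mapsTo hu) _ (hbij.mapsTo hw), hφ hu, hφ hw]
  refine ⟨hbij, hadj, fun u w huw => ?_, fun u hu => ?_, fun u hu => ?_, fun u hu => ?_⟩
  · have hport := h.port_eq _ _ ((hadj _ huw.2.1 _ huw.2.2.1).1 huw)
    rw [hport, hφ huw.2.1, hφ huw.2.2.1]
  · rw [h.ident_eq _ (hbij.mapsTo hu), hφ hu]
  · rw [h.label_eq _ (hbij.mapsTo hu), hφ hu]
  · rw [h.halfLabels_eq _ (hbij.mapsTo hu), hφ hu]

theorem exists_leftInvOn (hsize : G.size = H.size) {A : Set G.V} (hφ : Set.InjOn φ A) :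
    ∃ ψ : H.V → G.V, Set.LeftInvOn ψ φ A := by
  cases isEmpty_or_nonempty G.V
  · have : IsEmpty H.V := Fintype.card_eq_zero_iff.1 (hsize.symm.trans Fintype.card_eq_zero)
    exact ⟨isEmptyElim, fun v => isEmptyElim v⟩
  · exact ⟨_, hφ.leftInvOn_invFunOn⟩

end Ball

end Network

theorem log_two_le_succ {k k' : ℕ} (h : k' ≤ 2 * k + 1) (hk : k ≠ 0) :
    Nat.log 2 k' ≤ Nat.log 2 k + 1 :=
  calc Nat.log 2 k' ≤ Nat.log 2 (2 * k + 1) := Nat.log_mono_right h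
    _ = Nat.log 2 ((2 * k + 1) / 2) + 1 := Nat.log_of_one_lt_of_le one_lt_two (by omega)
    _ = Nat.log 2 k + 1 := by rw [show (2 * k + 1) / 2 = k by omega]

namespace Network

variable {c : ℕ} {N : Network c Color Unit} {V' : Type}

/-- A necessary condition for a node of the gadget graph to be at distance at most `s` from the
port-gadget roots of the nodes in `W`. Port-gadgets have height `h`, so that every node of `N` on
the way costs at least `h` steps; inside head-gadgets no steps are counted. A node of a port-gadget
is reached either through the root or through the left-most leaf. -/
inductive Near (N : Network c Color Unit) (h : ℕ) (W : Set N.V) (s : ℕ) :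
    (N.V ⊕ V') × ℕ × ℕ → Prop
  | center {v δ k} (hv : v ∈ N.ball W δ) (hs : δ * h ≤ s) : Near N h W s (.inl v, 0, k)
  | throughRoot {v δ i k} (hv : v ∈ N.ball W δ) (hs : δ * h + Nat.log 2 k ≤ s) :
      Near N h W s (.inl v, i + 1, k)
  | throughLeaf {v δ i k} (hv : N.nbr v i ∈ N.ball W δ) (hs : δ * h + h ≤ s + Nat.log 2 k) :
      Near N h W s (.inl v, i + 1, k)

namespace Near

variable {h : ℕ} {W : Set N.V} {s : ℕ}

theorem exists_eq_inl {v : N.V ⊕ V'} {tk : ℕ × ℕ} (hx : N.Near h W s (v, tk)) :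
    ∃ u, v = .inl u := by
  cases hx <;> exact ⟨_, rfl⟩

theorem mono {s' : ℕ} (hs' : s ≤ s') {x : (N.V ⊕ V') × ℕ × ℕ} (hx : N.Near h W s x) :
    N.Near h W s' x := by
  cases hx with
  | center hv hs => exact .center hv (hs.trans hs')
  | throughRoot hv hs => exact .throughRoot hv (hs.trans hs')
  | throughLeaf hv hs => exact .throughLeaf hv (hs.trans (Nat.add_le_add_right hs' _))

theorem tree_step {v : N.V ⊕ V'} {t k k' : ℕ} (hx : N.Near h W s (v, t, k)) (hk : k ≠ 0)
    (hk' : k' ≠ 0) (hle : k' ≤ 2 * k + 1) (hle' : k ≤ 2 * k' + 1) :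
    N.Near h W (s + 1) (v, t, k') := by
  have hlog := log_two_le_succ hle hk
  have hlog' := log_two_le_succ hle' hk'
  cases hx with
  | center hv hs => exact .center hv (by omega)
  | throughRoot hv hs => exact .throughRoot hv (by omega)
  | throughLeaf hv hs => exact .throughLeaf hv (by omega)

theorem port_step {v : N.V ⊕ V'} {k : ℕ} (hx : N.Near h W s (v, 0, k)) (i : ℕ) :
    N.Near h W (s + 1) (v, i + 1, 1) := by
  cases hx with
  | center hv hs => exact .throughRoot hv (by rw [Nat.log_one_right]; omega)

theorem up_step {v : N.V} {i : ℕ} (hi : i < (N.halfLabels v).length)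
    (hx : N.Near h W s ((.inl v, i + 1, 1) : (N.V ⊕ V') × ℕ × ℕ)) (k : ℕ) :
    N.Near h W (s + 1) ((.inl v, 0, k) : (N.V ⊕ V') × ℕ × ℕ) := by
  cases hx with
  | throughRoot hv hs => exact .center hv (by omega)
  | throughLeaf hv hs =>
    rw [Nat.log_one_right] at hs
    refine .center (mem_ball_of_adj hv (N.nbr_spec hi).1.symm) ?_
    rw [add_mul]
    omega

variable [NeZero h]

theorem outward_step {v : N.V} {i : ℕ} (hi : i < (N.halfLabels v).length)
    (hx : N.Near h W s ((.inl v, i + 1, 2 ^ (h - 1)) : (N.V ⊕ V') × ℕ × ℕ)) :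
    N.Near h W (s + 1) ((.inl (N.nbr v i), 0, 0) : (N.V ⊕ V') × ℕ × ℕ) := by
  have hh := NeZero.pos h
  have hlog : Nat.log 2 (2 ^ (h - 1)) = h - 1 := Nat.log_pow one_lt_two _
  cases hx with
  | throughRoot hv hs =>
    rw [hlog] at hs
    refine .center (mem_ball_of_adj hv (N.nbr_spec hi).1) ?_
    rw [add_mul]
    omega
  | throughLeaf hv hs =>
    rw [hlog] at hs
    exact .center hv (by omega)

theorem inward_step {b : N.V} {j : ℕ} (hj : j < (N.halfLabels b).length)
    (hx : N.Near h W s ((.inl b, 0, 0) : (N.V ⊕ V') × ℕ × ℕ)) :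
    N.Near h W (s + 1)
      ((.inl (N.nbr b j), N.port (N.nbr b j) b + 1, 2 ^ (h - 1)) : (N.V ⊕ V') × ℕ × ℕ) := by
  have hh := NeZero.pos h
  have hlog : Nat.log 2 (2 ^ (h - 1)) = h - 1 := Nat.log_pow one_lt_two _
  cases hx with
  | center hv hs =>
    rw [← N.nbr_port (N.nbr_spec hj).1.symm] at hv
    exact .throughLeaf hv (by omega)

variable {hN : N.ProperlyColored} {L' : Layout V'}

theorem step_octopus {a : HalfKind} {v : N.V ⊕ V'} {t k : ℕ} (hx : N.Near h W s (v, t, k))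
    (hvalid : ((N.layout h hN).sum L').Valid (v, t, k)) (hk : k ≠ 0)
    (ha : ((N.layout h hN).sum L').HasHalfEdge a (v, t, k)) :
    N.Near h W (s + 1) (((N.layout h hN).sum L').target a (v, t, k)) := by
  obtain ⟨u, rfl⟩ := hx.exists_eq_inl
  have ht : t ≤ (N.halfLabels u).length := (hvalid.octopus hk).2.2.1
  cases a with
  | left =>
    have hk1 : k ≠ 1 := fun h => ha (h ▸ Nat.isPowerOfTwo_one)
    exact hx.tree_step (k' := k - 1) hk (by omega) (by omega) (by omega)
  | right => exact hx.tree_step (k' := k + 1) hk (by omega) (by omega) (by omega)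
  | childL => exact hx.tree_step (k' := 2 * k) hk (by omega) (by omega) (by omega)
  | childR => exact hx.tree_step (k' := 2 * k + 1) hk (by omega) (by omega) (by omega)
  | parent =>
    have hk2 : 2 ≤ k := ha
    exact hx.tree_step (k' := k / 2) hk (by omega) (by omega) (by omega)
  | portA | portB =>
    obtain ⟨rfl : t = 0, -⟩ := ha
    exact hx.port_step _
  | up =>
    obtain ⟨ht0 : t ≠ 0, rfl : k = 1⟩ := ha
    obtain ⟨i, rfl⟩ := Nat.exists_eq_succ_of_ne_zero ht0
    exact hx.up_step ht _
  | outward =>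
    obtain ⟨ht0 : t ≠ 0, rfl : k = 2 ^ (h - 1)⟩ := ha
    obtain ⟨i, rfl⟩ := Nat.exists_eq_succ_of_ne_zero ht0
    exact hx.outward_step ht
  | inward => exact ha.elim

theorem step {a : HalfKind} {x y : (N.V ⊕ V') × ℕ × ℕ} (hx : N.Near h W s x)
    (hvalid : ((N.layout h hN).sum L').Valid x) (hstep : ((N.layout h hN).sum L').step a x y) :
    N.Near h W (s + 1) y := by
  obtain ⟨v, t, k⟩ := x
  rcases eq_or_ne k 0 with rfl | hk
  · obtain ⟨-, rfl⟩ := hvalid.inter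
    obtain ⟨u, rfl⟩ := hx.exists_eq_inl
    obtain ⟨-, j, hj, rfl⟩ := (Layout.step_inter rfl).1 hstep
    exact hx.inward_step hj
  · obtain ⟨ha, rfl⟩ := (Layout.step_octopus hk).1 hstep
    exact hx.step_octopus hvalid hk ha

end Near

/-- The nodes of `N` whose gadgets can be visible within distance `T` from the port-gadget roots of
the nodes in `A`, when the port-gadgets have height `h`. If `T < h`, no port-gadget can be
crossed. -/
def zone (N : Network c Color Unit) (A : Set N.V) (h T : ℕ) : Set N.V :=
  {v | v ∈ N.ball A (T / h + 1) ∧ (T < h → v ∈ A ∧ N.label v = .white)}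

variable {A : Set N.V} {h T : ℕ}

variable [NeZero h]

theorem zone_subset_ball : N.zone A h T ⊆ N.ball A (3 * (T / h)) := by
  rintro v ⟨hv, hsmall⟩
  rcases lt_or_ge T h with hlt | hge
  · exact subset_ball (hsmall hlt).1
  · have hpos := Nat.div_pos hge (NeZero.pos h)
    exact ball_mono (by omega) hv

theorem Near.mem_zone {hN : N.ProperlyColored} {L' : Layout V'} {v : N.V} {tk : ℕ × ℕ}
    (hx : N.Near h {v ∈ A | N.label v = .white} T ((.inl v, tk) : (N.V ⊕ V') × ℕ × ℕ))
    (hvalid : ((N.layout h hN).sum L').Valid (.inl v, tk)) : v ∈ N.zone A h T := by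
  have hball {δ : ℕ} {u : N.V} (hu : u ∈ N.ball {v ∈ A | N.label v = .white} δ)
      (hδ : δ * h ≤ T) : u ∈ N.ball A (T / h) ∧ (T < h → u ∈ A ∧ N.label u = .white) := by
    have hdiv : δ ≤ T / h := (Nat.le_div_iff_mul_le (NeZero.pos h)).2 hδ
    refine ⟨ball_mono hdiv (ball_subset_ball (fun v hv => hv.1) hu), fun hlt => ?_⟩
    obtain rfl : δ = 0 := by rwa [Nat.div_eq_of_lt hlt, Nat.le_zero] at hdiv
    exact mem_ball_zero.1 hu
  cases hx with
  | center hv hs => exact ⟨ball_mono (Nat.le_succ _) (hball hv hs).1, (hball hv hs).2⟩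
  | throughRoot hv hs =>
    have hδ := hball hv ((Nat.le_add_right _ _).trans hs)
    exact ⟨ball_mono (Nat.le_succ _) hδ.1, hδ.2⟩
  | @throughLeaf _ δ i k hv hs =>
    have hk : k ≠ 0 := by
      rintro rfl
      exact Nat.succ_ne_zero i hvalid.inter.2
    obtain ⟨hwhite, -, hi, hlt⟩ := hvalid.octopus hk
    have hlog : Nat.log 2 k < h := Nat.log_lt_of_lt_pow hk hlt
    obtain ⟨hadj, -⟩ := N.nbr_spec (v := v) (i := i) hi
    have hδ := hball hv (by omega)
    exact ⟨mem_ball_of_adj hδ.1 hadj.symm, fun hT =>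
      absurd (Eq.trans hwhite (hδ.2 hT).2.symm) (hN _ _ hadj)⟩

variable {G H : Network c Color Unit} {A : Set G.V} {B : Set H.V} {φ : G.V → H.V}

/-- The map `φ` preserves the inputs of the nodes in the zone of `A` and the edges between them. -/
structure LocalIso (G H : Network c Color Unit) (A : Set G.V) (B : Set H.V) (h T : ℕ)
    (φ : G.V → H.V) : Prop where
  mapsTo : Set.MapsTo φ A B
  ident_eq : ∀ v ∈ G.zone A h T, G.ident v = H.ident (φ v)
  label_eq : ∀ v ∈ G.zone A h T, G.label v = H.label (φ v)
  halfLabels_eq : ∀ v ∈ G.zone A h T, G.halfLabels v = H.halfLabels (φ v)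
  nbr_eq : ∀ v ∈ G.zone A h T, ∀ i < (G.halfLabels v).length, G.nbr v i ∈ G.zone A h T →
    H.nbr (φ v) i = φ (G.nbr v i) ∧ H.port (φ (G.nbr v i)) (φ v) = G.port (G.nbr v i) v

theorem ViewIso.localIso (hG : G.ProperlyColored) (h0 : ViewIso G H A B 0 φ)
    (hT : ViewIso G H A B (3 * (T / h)) φ) : LocalIso G H A B h T φ where
  mapsTo _ hv := mem_ball_zero.1 (h0.bijOn.mapsTo (mem_ball_zero.2 hv))
  ident_eq v hv := hT.ident_eq v (zone_subset_ball hv)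
  label_eq v hv := hT.label_eq v (zone_subset_ball hv)
  halfLabels_eq v hv := hT.halfLabels_eq v (zone_subset_ball hv)
  nbr_eq v hv i hi hw := by
    obtain ⟨hadj, hport⟩ := G.nbr_spec hi
    have hge : h ≤ T := by
      by_contra! hlt
      exact hG _ _ hadj ((hv.2 hlt).2.trans (hw.2 hlt).2.symm)
    have hpos := Nat.div_pos hge (NeZero.pos h)
    have hview := viewAdj_of_mem_ball (show T / h + 1 < 3 * (T / h) by omega) hv.1 hadj
    have hview' := (hT.adj_iff _ hview.2.1 _ hview.2.2.1).1 hview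
    refine ⟨?_, (hT.port_eq _ _ hview.symm).symm⟩
    rw [← H.nbr_port hview'.1, ← hT.port_eq _ _ hview, hport]

theorem layout_sameGadget {hG : G.ProperlyColored} {hH : H.ProperlyColored} {V₁ V₂ : Type}
    {L₁ : Layout V₁} {L₂ : Layout V₂} {v : G.V} {w : H.V} (hlabel : G.label v = H.label w)
    (hhalf : G.halfLabels v = H.halfLabels w) :
    ((G.layout h hG).sum L₁).SameGadget ((H.layout h hH).sum L₂) (.inl v) (.inl w) where
  white_iff := Eq.congr_left hlabel
  deg_eq := congrArg List.length hhalf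
  portHeight_eq := rfl

end Network

namespace Network.GadgetLift

section LiftMap

variable {c : ℕ} {G H : Network c Color Unit} {hG : G.ProperlyColored} {hH : H.ProperlyColored}
  {h : ℕ} [NeZero h] {d M : ℕ} {DG : G.GadgetLift hG h d M} {DH : H.GadgetLift hH h d M}
  {A : Set G.V} {B : Set H.V} {T : ℕ} {φ : G.V → H.V}

variable (DG) in
/-- The roots of the port-gadgets of the white nodes in `A`. -/
def roots (A : Set G.V) : Set DG.network.V :=
  {x | ∃ v ∈ A, ∃ i hi, x = ⟨(.inl v, i + 1, 1), hi⟩}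

theorem near_of_mem_ball {s : ℕ} {x : DG.network.V} (hx : x ∈ DG.network.ball (DG.roots A) s) :
    G.Near h {v ∈ A | G.label v = .white} s x.1 := by
  induction s generalizing x with
  | zero =>
    obtain ⟨v, hv, i, hi, rfl⟩ := mem_ball_zero.1 hx
    have hwhite : G.label v = .white := (hi.octopus one_ne_zero).1
    exact .throughRoot (mem_ball_zero.2 ⟨hv, hwhite⟩) (by rw [Nat.log_one_right, zero_mul])
  | succ s ih =>
    rcases mem_ball_succ.1 hx with hx | ⟨u, hu, a, ha⟩
    · exact (ih hx).mono (Nat.le_succ s)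
    · exact (ih hu).step u.2 ha

theorem exists_mem_zone {x : DG.network.V} (hx : x ∈ DG.network.ball (DG.roots A) T) :
    ∃ v tk hv, x = ⟨(.inl v, tk), hv⟩ ∧ v ∈ G.zone A h T := by
  have hnear := near_of_mem_ball hx
  obtain ⟨⟨v, tk⟩, hv⟩ := x
  obtain ⟨u, rfl⟩ := hnear.exists_eq_inl
  exact ⟨u, tk, hv, rfl, hnear.mem_zone hv⟩

theorem step_of_localIso (hφ : LocalIso G H A B h T φ) {a : HalfKind} {v w : G.V} {tk tk' : ℕ × ℕ}
    (hv : v ∈ G.zone A h T) (hw : w ∈ G.zone A h T) (hvalid : DG.layout.Valid (.inl v, tk))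
    (hstep : DG.layout.step a (.inl v, tk) (.inl w, tk')) :
    DH.layout.step a (.inl (φ v), tk) (.inl (φ w), tk') ∧
      DG.layout.portNum (.inl v, tk) (.inl w, tk') =
        DH.layout.portNum (.inl (φ v), tk) (.inl (φ w), tk') := by
  have hsame {u : G.V} (hu : u ∈ G.zone A h T) :
      DG.layout.SameGadget DH.layout (.inl u) (.inl (φ u)) :=
    layout_sameGadget (hφ.label_eq u hu) (hφ.halfLabels_eq u hu)
  have hnbr (i : ℕ) (hi : i < (G.halfLabels v).length)
      (hi' : (Sum.inl (G.nbr v i) : G.V ⊕ Fin DG.m × Option (Fin d)) = .inl w) :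
      H.nbr (φ v) i = φ w ∧ H.port (φ w) (φ v) = G.port w v := by
    obtain rfl := Sum.inl_injective hi'
    exact hφ.nbr_eq v hv i hi hw
  obtain ⟨t, k⟩ := tk
  rcases eq_or_ne k 0 with rfl | hk
  · refine (hsame hv).step_inter (hsame hw) (fun i hi hi' => ?_) hstep
    obtain ⟨hnbr', hport⟩ := hnbr i hi hi'
    obtain rfl := Sum.inl_injective hi'
    exact ⟨congrArg Sum.inl hnbr', (congrArg (H.port · (φ v)) hnbr').trans hport⟩
  · exact (hsame hv).step_octopus hvalid hk (fun hwv => by rw [Sum.inl_injective hwv])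
      (fun i hi hi' => congrArg Sum.inl (hnbr i hi hi').1) hstep

variable [NeZero M]

instance : Nonempty DH.network.V :=
  Fintype.card_pos_iff.1 (DH.size_network.trans_gt (NeZero.pos M))

variable (DG DH) in
open Classical in
/-- The map between the proper instances that sends the gadget of `v` to the gadget of `φ v`, with
arbitrary values where this is impossible. -/
noncomputable def liftMap (φ : G.V → H.V) : DG.network.V → DH.network.V
  | ⟨(.inl v, tk), _⟩ =>
    if hv : DH.layout.Valid (.inl (φ v), tk) then ⟨_, hv⟩ else Classical.arbitrary _
  | ⟨(.inr _, _), _⟩ => Classical.arbitrary _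

theorem liftMap_mk {v : G.V} {tk : ℕ × ℕ} (hv : DG.layout.Valid (.inl v, tk))
    (hv' : DH.layout.Valid (.inl (φ v), tk)) :
    liftMap DG DH φ ⟨(.inl v, tk), hv⟩ = ⟨(.inl (φ v), tk), hv'⟩ :=
  dif_pos hv'

variable (DH) in
theorem exists_liftMap_eq (hφ : LocalIso G H A B h T φ) {x : DG.network.V}
    (hx : x ∈ DG.network.ball (DG.roots A) T) :
    ∃ v ∈ G.zone A h T, ∃ tk hv hv',
      x = ⟨(.inl v, tk), hv⟩ ∧ liftMap DG DH φ x = ⟨(.inl (φ v), tk), hv'⟩ := by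
  obtain ⟨v, tk, hv, rfl, hzone⟩ := exists_mem_zone hx
  have hv' : DH.layout.Valid (.inl (φ v), tk) :=
    (layout_sameGadget (hφ.label_eq v hzone) (hφ.halfLabels_eq v hzone)).valid_iff.1 hv
  exact ⟨v, hzone, tk, hv, hv', rfl, liftMap_mk hv hv'⟩

theorem step_liftMap (hφ : LocalIso G H A B h T φ) {a : HalfKind} {x y : DG.network.V}
    (hx : x ∈ DG.network.ball (DG.roots A) T) (hy : y ∈ DG.network.ball (DG.roots A) T)
    (hstep : DG.layout.step a x.1 y.1) :
    DH.layout.step a (liftMap DG DH φ x).1 (liftMap DG DH φ y).1 ∧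
      DG.network.port x y = DH.network.port (liftMap DG DH φ x) (liftMap DG DH φ y) := by
  obtain ⟨v, hv, tk, hvalid, hvalid', rfl, hlift⟩ := exists_liftMap_eq DH hφ hx
  obtain ⟨w, hw, tk', _, _, rfl, hlift'⟩ := exists_liftMap_eq DH hφ hy
  rw [hlift, hlift']
  exact step_of_localIso hφ hv hw hvalid hstep

theorem liftMap_mem_ball (hφ : LocalIso G H A B h T φ) {s : ℕ} (hs : s ≤ T) {x : DG.network.V}
    (hx : x ∈ DG.network.ball (DG.roots A) s) :
    liftMap DG DH φ x ∈ DH.network.ball (DH.roots B) s := by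
  induction s generalizing x with
  | zero =>
    obtain ⟨v, -, tk, hv, hv', rfl, hlift⟩ := exists_liftMap_eq DH hφ (ball_mono hs hx)
    obtain ⟨u, hu, i, hi, heq⟩ := mem_ball_zero.1 hx
    obtain ⟨hvu, rfl⟩ := Prod.mk.inj (congrArg Subtype.val heq)
    obtain rfl := Sum.inl_injective hvu
    exact mem_ball_zero.2 ⟨φ v, hφ.mapsTo hu, i, hv', hlift⟩
  | succ s ih =>
    rcases mem_ball_succ.1 hx with hx' | ⟨u, hu, a, ha⟩
    · exact ball_mono (Nat.le_succ s) (ih (by omega) hx')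
    · exact mem_ball_of_adj (ih (by omega) hu)
        ⟨a, (step_liftMap hφ (ball_mono (by omega) hu) (ball_mono hs hx) ha).1⟩

theorem viewAdj_liftMap (hφ : LocalIso G H A B h T φ) {x y : DG.network.V}
    (hxy : DG.network.ViewAdj (DG.roots A) T x y) :
    DH.network.ViewAdj (DH.roots B) T (liftMap DG DH φ x) (liftMap DG DH φ y) := by
  obtain ⟨⟨a, ha⟩, hx, hy, hopen⟩ := hxy
  have hmem {x} (hx : x ∈ DG.network.openBall (DG.roots A) T) :
      liftMap DG DH φ x ∈ DH.network.openBall (DH.roots B) T := by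
    obtain ⟨s, hs, hx⟩ := mem_openBall_iff.1 hx
    exact mem_openBall_iff.2 ⟨s, hs, liftMap_mem_ball hφ hs.le hx⟩
  exact ⟨⟨a, (step_liftMap hφ hx hy ha).1⟩, liftMap_mem_ball hφ le_rfl hx,
    liftMap_mem_ball hφ le_rfl hy, hopen.imp hmem hmem⟩

theorem leftInvOn_liftMap {ψ : H.V → G.V} (hφ : LocalIso G H A B h T φ)
    (hψφ : Set.LeftInvOn ψ φ (G.zone A h T)) :
    Set.LeftInvOn (liftMap DH DG ψ) (liftMap DG DH φ) (DG.network.ball (DG.roots A) T) := by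
  intro x hx
  obtain ⟨v, hzone, tk, hv, hv', rfl, hlift⟩ := exists_liftMap_eq DH hφ hx
  rw [hlift, liftMap_mk hv' (by rwa [hψφ hzone])]
  exact Subtype.ext (congrArg (fun u => (Sum.inl u, tk)) (hψφ hzone))

theorem viewIso_of_localIso {ψ : H.V → G.V} (hsize : G.size = H.size)
    (hφ : LocalIso G H A B h T φ) (hψ : LocalIso H G B A h T ψ)
    (hψφ : Set.LeftInvOn ψ φ (G.zone A h T)) (hφψ : Set.LeftInvOn φ ψ (H.zone B h T)) :
    ViewIso DG.network DH.network (DG.roots A) (DH.roots B) T (liftMap DG DH φ) where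
  bijOn := Set.InvOn.bijOn ⟨leftInvOn_liftMap hφ hψφ, leftInvOn_liftMap hψ hφψ⟩
    (fun _ => liftMap_mem_ball hφ le_rfl) (fun _ => liftMap_mem_ball hψ le_rfl)
  adj_iff x hx y hy := by
    refine ⟨viewAdj_liftMap hφ, fun hxy => ?_⟩
    have hxy' := viewAdj_liftMap (DH := DG) hψ hxy
    rwa [leftInvOn_liftMap hφ hψφ hx, leftInvOn_liftMap hφ hψφ hy] at hxy'
  port_eq x y hxy := by
    obtain ⟨⟨a, ha⟩, hx, hy, -⟩ := hxy
    exact (step_liftMap hφ hx hy ha).2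
  ident_eq x hx := by
    obtain ⟨v, hzone, tk, hv, hv', rfl, hlift⟩ := exists_liftMap_eq DH hφ hx
    rw [hlift]
    refine (DG.id_eq v tk hv).trans (Eq.trans ?_ (DH.id_eq (φ v) tk hv').symm)
    rw [blockIdent, blockIdent, hsize, hφ.ident_eq v hzone]
  label_eq x hx := by
    obtain ⟨v, -, tk, hv, hv', rfl, hlift⟩ := exists_liftMap_eq DH hφ hx
    rw [hlift]
    rfl
  halfLabels_eq x hx := by
    obtain ⟨v, hzone, tk, hv, hv', rfl, hlift⟩ := exists_liftMap_eq DH hφ hx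
    rw [hlift]
    exact (layout_sameGadget (hφ.label_eq v hzone) (hφ.halfLabels_eq v hzone)).labels_eq

theorem viewIso_of_viewIso (hsize : G.size = H.size) (h0 : ViewIso G H A B 0 φ)
    (hT : ViewIso G H A B (3 * (T / h)) φ) :
    ViewIso DG.network DH.network (DG.roots A) (DH.roots B) T (liftMap DG DH φ) := by
  obtain ⟨ψ, hψ⟩ := exists_leftInvOn hsize hT.bijOn.injOn
  have h0' := h0.symm (hψ.mono (ball_mono (Nat.zero_le _)))
  exact viewIso_of_localIso hsize (h0.localIso hG hT) (h0'.localIso hH (hT.symm hψ))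
    (hψ.mono zone_subset_ball) ((hT.rightInvOn hψ).mono zone_subset_ball)

end LiftMap

section Decode

variable {c : ℕ} {S : Type} {G H : Network c Color Unit} {hG : G.ProperlyColored}
  {hH : H.ProperlyColored} {h : ℕ} [NeZero h] {d M : ℕ} {DG : G.GadgetLift hG h d M}
  {DH : H.GadgetLift hH h d M} {A : Set G.V} {B : Set H.V} {φ : G.V → H.V}

theorem decode_congr {y y' : DG.network.V → Option S} (hy : Set.EqOn y y' (DG.roots A)) {v : G.V}
    (hv : v ∈ A) : DG.decode y v = DG.decode y' v :=
  (layout_sameGadget rfl rfl).decode_eq fun i hi _ => hy ⟨v, hv, i, hi, rfl⟩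

theorem measure_decode_le {P : LinearizableProblem S} {O : Outcome c NodeKind HalfKind (Option S)}
    {p : ℕ → ℝ} (hO : (P.promise c).SolvedBy O p) (hd : d ∈ P.sizes)
    (hGP : G ∈ (P.problem c).inputs) :
    ((O DG.network).map DG.decode).toOuterMeasure {y | ¬ (P.problem c).Solution G y} ≤
      ENNReal.ofReal (p M) := by
  have hle := hO _ (DG.network_mem hGP hd)
  rw [DG.size_network] at hle
  rw [PMF.toOuterMeasure_map_apply]
  refine (MeasureTheory.measure_mono fun y hy hsol => ?_).trans hle
  exact hy (DG.decode_solution hGP hsol)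

variable [NeZero M]

theorem decode_comp_liftMap (h0 : ViewIso G H A B 0 φ) (y : DH.network.V → Option S) {v : G.V}
    (hv : v ∈ A) : DG.decode (fun x => y (liftMap DG DH φ x)) v = DH.decode y (φ v) :=
  have hv' := mem_ball_zero.2 hv
  (layout_sameGadget (h0.label_eq v hv') (h0.halfLabels_eq v hv')).decode_eq fun _ hi hi' =>
    congrArg y (liftMap_mk hi hi')

theorem map_decode_eq {P : LinearizableProblem S} {O : Outcome c NodeKind HalfKind (Option S)}
    {T : ℕ → ℕ} (hO : (P.promise c).NonSignaling O T) (hd : d ∈ P.sizes)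
    (hGP : G ∈ (P.problem c).inputs) (hHP : H ∈ (P.problem c).inputs) (hsize : G.size = H.size)
    (h0 : ViewIso G H A B 0 φ) (hT : ViewIso G H A B (3 * (T M / h)) φ) :
    (O DG.network).map (fun y (a : A) => DG.decode y a) =
      (O DH.network).map fun y (a : A) => DH.decode y (φ a) := by
  let F (g : DG.roots A → Option S) (a : A) : List S :=
    DG.decode (Function.extend Subtype.val g fun _ => none) a
  have hF (y : DG.network.V → Option S) :
      F (fun x => y x.1) = fun a : A => DG.decode y a := funext fun a =>
    decode_congr (fun x hx => Subtype.val_injective.extend_apply _ _ (⟨x, hx⟩ : DG.roots A)) a.2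
  have hviews : (O DG.network).map (fun y (x : DG.roots A) => y x.1) =
      (O DH.network).map fun y (x : DG.roots A) => y (liftMap DG DH φ x.1) := by
    refine hO _ (DG.network_mem hGP hd) _ (DH.network_mem hHP hd)
      (DG.size_network.trans DH.size_network.symm) (DG.roots A) (DH.roots B) _
      (viewIso_of_viewIso hsize h0 ?_) (viewIso_of_viewIso hsize h0 ?_)
    · rwa [Nat.zero_div]
    · rwa [DG.size_network]
  calc (O DG.network).map (fun y (a : A) => DG.decode y a)
      = ((O DG.network).map fun y (x : DG.roots A) => y x.1).map F := by
        rw [PMF.map_comp]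
        exact congrArg (PMF.map · _) (funext fun y => (hF y).symm)
    _ = ((O DH.network).map fun y (x : DG.roots A) => y (liftMap DG DH φ x.1)).map F := by
        rw [hviews]
    _ = (O DH.network).map fun y (a : A) => DH.decode y (φ a) := by
        rw [PMF.map_comp]
        refine congrArg (PMF.map · _) (funext fun y => (hF fun x => y (liftMap DG DH φ x)).trans ?_)
        exact funext fun a => decode_comp_liftMap h0 y a.2

end Decode

end Network.GadgetLift

/-! ### Locality bounds -/

namespace Network

/-- The height of the port-gadgets that replace the nodes of an `n`-node network. It is of order
`log n`, and the subtraction of `2` makes a gadget small enough for the proper instance to fit into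
`n ^ 3` nodes. -/
def gadgetHeight (n : ℕ) : ℕ := max 1 (Nat.log 2 n - 2)

instance (n : ℕ) : NeZero (gadgetHeight n) := ⟨by rw [gadgetHeight]; omega⟩

theorem log_le_three_mul_gadgetHeight (n : ℕ) : Real.log n ≤ 3 * gadgetHeight n := by
  have hlog : Real.log n ≤ (Nat.log 2 n + 1) * Real.log 2 := by
    rcases Nat.eq_zero_or_pos n with rfl | hn
    · rw [Nat.cast_zero, Real.log_zero]
      positivity
    · rw [← Nat.cast_succ, ← Real.log_pow]
      exact Real.log_le_log (Nat.cast_pos.2 hn)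
        (mod_cast (Nat.lt_pow_succ_log_self one_lt_two n).le)
  have hone : (1 : ℝ) ≤ gadgetHeight n := mod_cast le_max_left 1 _
  have hle : (Nat.log 2 n : ℝ) ≤ gadgetHeight n + 2 := by
    exact_mod_cast Nat.sub_le_iff_le_add.1 (le_max_right 1 (Nat.log 2 n - 2))
  have htwo := Real.log_two_lt_d9
  have htwo' := Real.log_two_gt_d9
  nlinarith

theorem four_mul_two_pow_gadgetHeight_le {n : ℕ} (hn : 8 ≤ n) : 4 * 2 ^ gadgetHeight n ≤ n := by
  have hlog : 3 ≤ Nat.log 2 n := Nat.le_log_of_pow_le one_lt_two hn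
  calc 4 * 2 ^ gadgetHeight n = 2 ^ (2 + gadgetHeight n) := by rw [pow_add]; rfl
    _ = 2 ^ Nat.log 2 n := by rw [gadgetHeight]; congr 1; omega
    _ ≤ n := Nat.pow_log_le_self 2 (by omega)

theorem mul_blockSize_gadgetHeight_add_le {n d : ℕ} (hn : 24 * d + 16 ≤ n) :
    n * blockSize n (gadgetHeight n) + (6 * d + 3) ≤ n ^ 3 := by
  have hpow := four_mul_two_pow_gadgetHeight_le (n := n) (by omega)
  rw [blockSize]
  have hsq : n ≤ n * n := Nat.le_mul_self n
  have hcube : n * n * 16 ≤ n * n * n := Nat.mul_le_mul_left _ (by omega)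
  have hgadget : n * n * (4 * 2 ^ gadgetHeight n) ≤ n * n * n := Nat.mul_le_mul_left _ hpow
  nlinarith

theorem le_mul_blockSize (n h : ℕ) : n ≤ n * blockSize n h := by
  rcases Nat.eq_zero_or_pos n with rfl | hn
  · exact Nat.zero_le _
  · exact Nat.le_mul_of_pos_right _ (Nat.mul_pos hn (Nat.succ_pos _))

end Network

namespace LinearizableProblem

open Network

variable {S : Type} {P : LinearizableProblem S} {c : ℕ}

theorem solution_nil (hP : P.sizes = ∅) {N : Network c Color Unit}
    (hN : N ∈ (P.problem c).inputs) : (P.problem c).Solution N fun _ => [] := by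
  have hwhite (v : N.V) : N.label v = .white := by
    by_contra hv
    have hdeg := hN.2 v (Color.eq_black_of_ne_white hv)
    rw [hP] at hdeg
    exact Finset.notMem_empty _ hdeg
  have hnbr (v : N.V) : N.graph.neighborSet v = ∅ :=
    Set.eq_empty_of_forall_notMem fun w hw => hN.1 v w hw ((hwhite v).trans (hwhite w).symm)
  refine ⟨fun v _ => ⟨?_, ?_, ?_, .nil⟩, fun u hu => nomatch (hwhite u).symm.trans hu⟩
  · rw [degree, hnbr, Set.ncard_empty, List.length_nil]
  all_goals exact fun s hs => nomatch hs

theorem solvableNS_zero_of_sizes_eq_empty (hP : P.sizes = ∅) (p : ℕ → ℝ) :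
    (P.problem c).SolvableNS p fun _ => 0 := by
  refine ⟨fun N => PMF.pure fun _ => [], fun G _ H _ _ A B φ _ _ => ?_, fun N hN => ?_⟩
  · rw [PMF.pure_map, PMF.pure_map]
  · have hvalid : (fun _ => []) ∉ {y : N.V → List S | ¬ (P.problem c).Solution N y} :=
      not_not_intro (solution_nil hP hN)
    rw [PMF.toOuterMeasure_pure_apply, if_neg hvalid]
    exact zero_le

section Pullback

variable {d : ℕ} {M h : ℕ → ℕ} [∀ n, NeZero (h n)]

open Classical in
/-- The outcome that runs `O` on proper instances that replace the input networks and reads off the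
labels of the port-gadgets. -/
noncomputable def pullback (O : Outcome c NodeKind HalfKind (Option S))
    (D : ∀ (n : ℕ) (N : Network c Color Unit) (hN : N.ProperlyColored),
      N.size = n → N.GadgetLift hN (h n) d (M n)) : Outcome c Color Unit (List S) := fun N =>
  if hN : N.ProperlyColored then (O (D _ N hN rfl).network).map (D _ N hN rfl).decode
  else PMF.pure fun _ => []

variable {O : Outcome c NodeKind HalfKind (Option S)}
  {D : ∀ (n : ℕ) (N : Network c Color Unit) (hN : N.ProperlyColored),
    N.size = n → N.GadgetLift hN (h n) d (M n)}

theorem pullback_apply {n : ℕ} {N : Network c Color Unit} (hN : N.ProperlyColored)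
    (hn : N.size = n) : pullback O D N = (O (D n N hN hn).network).map (D n N hN hn).decode := by
  subst hn
  exact dif_pos hN

theorem nonSignaling_pullback [∀ n, NeZero (M n)] {T : ℕ → ℕ}
    (hO : (P.promise c).NonSignaling O T) (hd : d ∈ P.sizes) :
    (P.problem c).NonSignaling (pullback O D) fun n => 3 * (T (M n) / h n) := by
  intro G hG H hH hsize A B φ h0 hT
  rw [pullback_apply hG.1 rfl, pullback_apply hH.1 hsize.symm, PMF.map_comp, PMF.map_comp]
  exact GadgetLift.map_decode_eq hO hd hG hH hsize h0 hT

theorem solvedBy_pullback {p : ℕ → ℝ} (hO : (P.promise c).SolvedBy O p) (hd : d ∈ P.sizes) :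
    (P.problem c).SolvedBy (pullback O D) fun n => p (M n) := by
  intro N hN
  rw [pullback_apply hN.1 rfl]
  exact GadgetLift.measure_decode_le hO hd hN

theorem solvableNS_of_promise (hc : c ≠ 0) (hd : d ∈ P.sizes) {p : ℕ → ℝ} (hp : Antitone p)
    {T : ℕ → ℕ} (hs : (P.promise c).SolvableNS p T)
    (hM : ∀ n, n * blockSize n (h n) + (6 * d + 3) ≤ M n) :
    (P.problem c).SolvableNS p fun n => 3 * (T (M n) / h n) := by
  obtain ⟨O, hO, hsol⟩ := hs
  have hlift (n : ℕ) (N : Network c Color Unit) (hN : N.ProperlyColored) (hn : N.size = n) :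
      Nonempty (N.GadgetLift hN (h n) d (M n)) :=
    nonempty_gadgetLift hc (hn ▸ hM n)
  have (n : ℕ) : NeZero (M n) := ⟨by have := hM n; omega⟩
  refine ⟨pullback O fun n N hN hn => (hlift n N hN hn).some, nonSignaling_pullback hO hd,
    fun N hN => (solvedBy_pullback hsol hd N hN).trans (ENNReal.ofReal_le_ofReal (hp ?_))⟩
  exact (le_mul_blockSize N.size _).trans ((Nat.le_add_right _ _).trans (hM N.size))

end Pullback

theorem exists_solvableNS_of_promise (hc : c ≠ 0) {p : ℕ → ℝ} (hp : Antitone p) {T : ℕ → ℕ}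
    (hs : (P.promise c).SolvableNS p T) {M : ℕ → ℕ} (hM : ∀ n, n ^ 3 ≤ M n) :
    ∃ T' : ℕ → ℕ, (P.problem c).SolvableNS p T' ∧
      ∀ᶠ n : ℕ in atTop, (T' n : ℝ) ≤ 9 * ((T (M n) : ℝ) / Real.log n) := by
  rcases P.sizes.eq_empty_or_nonempty with hP | ⟨d, hd⟩
  · refine ⟨_, solvableNS_zero_of_sizes_eq_empty hP p, Eventually.of_forall fun n => ?_⟩
    have := Real.log_natCast_nonneg n
    rw [Nat.cast_zero]
    positivity
  refine ⟨_, solvableNS_of_promise hc hd hp hs (h := gadgetHeight)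
    (M := fun n => max (M n) (n * blockSize n (gadgetHeight n) + (6 * d + 3)))
    fun n => le_max_right _ _, ?_⟩
  filter_upwards [eventually_ge_atTop (24 * d + 16)] with n hn
  rw [max_eq_left ((mul_blockSize_gadgetHeight_add_le hn).trans (hM n))]
  have hlogpos : 0 < Real.log n := Real.log_pos (Nat.one_lt_cast.2 (by omega))
  calc ((3 * (T (M n) / gadgetHeight n) : ℕ) : ℝ)
      ≤ 3 * ((T (M n) : ℝ) / gadgetHeight n) := by
        push_cast
        gcongr
        exact Nat.cast_div_le
    _ ≤ 3 * ((T (M n) : ℝ) / (Real.log n / 3)) := by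
        gcongr
        linarith [log_le_three_mul_gadgetHeight n]
    _ = 9 * ((T (M n) : ℝ) / Real.log n) := by
        ring

end LinearizableProblem

section CubeRoot

theorem rpow_third_pow_three (n : ℕ) : ((n : ℝ) ^ (1 / 3 : ℝ)) ^ 3 = n := by
  rw [one_div]
  exact_mod_cast Real.rpow_inv_natCast_pow n.cast_nonneg three_ne_zero

theorem floor_rpow_third_pow_le (n : ℕ) : ⌊(n : ℝ) ^ (1 / 3 : ℝ)⌋₊ ^ 3 ≤ n := by
  have hpow := pow_le_pow_left₀ (Nat.cast_nonneg _)
    (Nat.floor_le (Real.rpow_nonneg n.cast_nonneg (1 / 3))) 3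
  rw [rpow_third_pow_three] at hpow
  exact_mod_cast hpow

theorem lt_floor_rpow_third_add_one_pow (n : ℕ) :
    n < (⌊(n : ℝ) ^ (1 / 3 : ℝ)⌋₊ + 1) ^ 3 := by
  have hpow := pow_lt_pow_left₀ (Nat.lt_floor_add_one ((n : ℝ) ^ (1 / 3 : ℝ)))
    (Real.rpow_nonneg n.cast_nonneg _) three_ne_zero
  rw [rpow_third_pow_three] at hpow
  exact_mod_cast hpow

theorem tendsto_floor_rpow_third_atTop :
    Tendsto (fun n : ℕ => ⌊(n : ℝ) ^ (1 / 3 : ℝ)⌋₊) atTop atTop :=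
  tendsto_nat_floor_atTop.comp
    ((tendsto_rpow_atTop (by norm_num)).comp tendsto_natCast_atTop_atTop)

theorem log_le_six_mul_log {m n : ℕ} (hm : 2 ≤ m) (hn : n < (m + 1) ^ 3) :
    Real.log n ≤ 6 * Real.log m := by
  rcases Nat.eq_zero_or_pos n with rfl | hpos
  · rw [Nat.cast_zero, Real.log_zero]
    exact mul_nonneg (by norm_num) (Real.log_natCast_nonneg m)
  have hle : n ≤ m ^ 6 := calc
    n ≤ (m + 1) ^ 3 := hn.le
    _ ≤ (m ^ 2) ^ 3 := Nat.pow_le_pow_left (by nlinarith) 3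
    _ = m ^ 6 := (pow_mul m 2 3).symm
  calc Real.log n ≤ Real.log ((m : ℝ) ^ 6) :=
        Real.log_le_log (Nat.cast_pos.2 hpos) (by exact_mod_cast hle)
    _ = 6 * Real.log m := by rw [Real.log_pow, Nat.cast_ofNat]

theorem exists_min_between_cubes (f : ℕ → ℕ) (m : ℕ) :
    ∃ k, m ^ 3 ≤ k ∧ ∀ n, m ^ 3 ≤ n → n < (m + 1) ^ 3 → f k ≤ f n := by
  have hne : (Finset.Ico (m ^ 3) ((m + 1) ^ 3)).Nonempty :=
    Finset.nonempty_Ico.2 (Nat.pow_lt_pow_left m.lt_succ_self three_ne_zero)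
  obtain ⟨k, hk, hmin⟩ := Finset.exists_min_image _ f hne
  exact ⟨k, (Finset.mem_Ico.1 hk).1, fun n hle hlt => hmin n (Finset.mem_Ico.2 ⟨hle, hlt⟩)⟩

end CubeRoot

theorem LinearizableProblem.eventually_le_of_promise {S : Type} {P : LinearizableProblem S}
    {c : ℕ} (hc : c ≠ 0) {p : ℕ → ℝ} (hp : Antitone p) {T : ℕ → ℝ}
    (hlow : ∀ T' : ℕ → ℕ, (P.problem c).SolvableNS p T' → ∀ᶠ n : ℕ in atTop, T n ≤ T' n)
    {T' : ℕ → ℕ} (hT' : (P.promise c).SolvableNS p T') :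
    ∀ᶠ n : ℕ in atTop, 1 / 54 * (T ⌊(n : ℝ) ^ (1 / 3 : ℝ)⌋₊ * Real.log n) ≤ T' n := by
  -- A sequence of sizes along which `T'` is smallest: `T'` need not be monotone.
  choose M hM hmin using exists_min_between_cubes T'
  obtain ⟨T₁, hT₁, hle⟩ := exists_solvableNS_of_promise hc hp hT' hM
  filter_upwards [tendsto_floor_rpow_third_atTop.eventually
    (((hlow T₁ hT₁).and hle).and (eventually_ge_atTop 2))] with n ⟨⟨hTm, hT₁m⟩, hm⟩
  have hT'n := hmin _ n (floor_rpow_third_pow_le n) (lt_floor_rpow_third_add_one_pow n)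
  have hlogn := log_le_six_mul_log hm (lt_floor_rpow_third_add_one_pow n)
  generalize ⌊(n : ℝ) ^ (1 / 3 : ℝ)⌋₊ = m at *
  have hlogm : 0 < Real.log m := Real.log_pos (Nat.one_lt_cast.2 hm)
  have := Real.log_natCast_nonneg n
  calc 1 / 54 * (T m * Real.log n)
      ≤ 1 / 54 * (9 * ((T' n : ℝ) / Real.log m) * (6 * Real.log m)) := by
        gcongr
        refine hTm.trans (hT₁m.trans ?_)
        gcongr
    _ = T' n := by
        field_simp
        ring

theorem mainTheorem5_general {S : Type} (P : LinearizableProblem S) {c : ℕ} (hc : c ≠ 0) :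
    (∃ C : ℝ, 0 < C ∧ ∀ p : ℕ → ℝ, Antitone p →
      ∀ T : ℕ → ℕ, ((P.promise c).SolvableNS p T ∨ (P.lift c).SolvableNS p T) →
        ∃ T' : ℕ → ℕ, (P.problem c).SolvableNS p T' ∧
          ∀ᶠ n : ℕ in atTop, (T' n : ℝ) ≤ C * ((T (n ^ 3) : ℝ) / Real.log n)) ∧
    (∃ κ : ℝ, 0 < κ ∧ ∀ p : ℕ → ℝ, Antitone p →
      ∀ T : ℕ → ℝ,
        (∀ T' : ℕ → ℕ, (P.problem c).SolvableNS p T' → ∀ᶠ n : ℕ in atTop, T n ≤ T' n) →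
        ∀ T' : ℕ → ℕ, ((P.promise c).SolvableNS p T' ∨ (P.lift c).SolvableNS p T') →
          ∀ᶠ n : ℕ in atTop,
            κ * (T ⌊(n : ℝ) ^ (1 / 3 : ℝ)⌋₊ * Real.log n) ≤ T' n) := by
  have hpromise {p : ℕ → ℝ} {T : ℕ → ℕ}
      (hT : (P.promise c).SolvableNS p T ∨ (P.lift c).SolvableNS p T) :
      (P.promise c).SolvableNS p T :=
    hT.elim id P.promise_solvableNS_of_lift
  refine ⟨⟨9, by norm_num, fun p hp T hT => ?_⟩, 1 / 54, by norm_num, fun p hp T hlow T' hT' => ?_⟩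
  · exact LinearizableProblem.exists_solvableNS_of_promise hc hp (hpromise hT) fun _ => le_rfl
  · exact LinearizableProblem.eventually_le_of_promise hc hp hlow (hpromise hT')

theorem mainTheorem5 {S : Type} [Fintype S] (P : LinearizableProblem S) (c : ℕ) (hc : 1 ≤ c) :
    -- turning outcomes for the promise problem, or for the lifted problem, into outcomes for `P`
    (∃ C : ℝ, 0 < C ∧ ∀ (p : ℕ → ℝ) (q : ℝ), Antitone p → (∀ n, p n ≤ q) → q < 1 →
      ∀ T : ℕ → ℕ, ((P.promise c).SolvableNS p T ∨ (P.lift c).SolvableNS p T) →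
        ∃ T' : ℕ → ℕ, (P.problem c).SolvableNS p T' ∧
          ∀ᶠ n : ℕ in atTop, (T' n : ℝ) ≤ C * ((T (n ^ 3) : ℝ) / Real.log n)) ∧
    -- the lower bound
    (∃ κ : ℝ, 0 < κ ∧ ∀ (p : ℕ → ℝ) (q : ℝ), Antitone p → (∀ n, p n ≤ q) → q < 1 →
      ∀ T : ℕ → ℝ,
        (∀ T' : ℕ → ℕ, (P.problem c).SolvableNS p T' → ∀ᶠ n : ℕ in atTop, T n ≤ T' n) →
        ∀ T' : ℕ → ℕ, ((P.promise c).SolvableNS p T' ∨ (P.lift c).SolvableNS p T') →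
          ∀ᶠ n : ℕ in atTop,
            κ * (T ⌊(n : ℝ) ^ (1 / 3 : ℝ)⌋₊ * Real.log n) ≤ T' n) :=
  have ⟨⟨C, hC, hupper⟩, κ, hκ, hlower⟩ := mainTheorem5_general P (Nat.one_le_iff_ne_zero.1 hc)
  ⟨⟨C, hC, fun p _ hp _ _ => hupper p hp⟩, κ, hκ, fun p _ hp _ _ => hlower p hp⟩
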